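/- For a real Banach space $E$ write $S(E)=\{x\in E:\|x\|=1\}$ for its unit sphere with the norm metric, and let $$\delta_E(\varepsilon)=\inf\Big\{1-\Big\|\frac{x+y}{2}\Big\| : \|x\|=\|y\|=1,\ \|x-y\|\ge\varepsilon\Big\}\quad(0<\varepsilon\le 2),$$ $$\rho_E(\tau)=\sup\Big\{\frac{\|x+y\|+\|x-y\|}{2}-1 : \|x\|=1,\ \|y\|=\tau\Big\}\quad(\tau>0)$$ be its moduli of uniform convexity and of uniform smoothness. $E$ is uniformly convex if $\delta_E(\varepsilon)>0$ for all $0<\varepsilon\le 2$, and uniformly smooth if $\rho_E(\tau)/\tau\to 0$ as $\tau\to 0^+$. A continuous function $f:[0,\infty)\to[0,\infty)$ with $f(0)=0$ is a modulus of continuity for a map $F:(A,d_1)\to(B,d_2)$ between metric spaces if $d_2(F(a_1),F(a_2))\le f(d_1(a_1,a_2))$ for all $a_1,a_2\in A$. **Theorem 2.3.** If $X$ and $Y$ are uniformly convex and uniformly smooth separable infinite-dimensional (real) Banach lattices, then there exists a uniform homeomorphism $F:S(X)\to S(Y)$ (a bijection such that $F$ and $F^{-1}$ are uniformly continuous) such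 that $F$ has a modulus of continuity $f$ depending solely on $\delta_Y$ and $\rho_X$, and $F^{-1}$ has a modulus of continuity $g$ depending solely on $\rho_Y$ and $\delta_X$. That is, there are assignments $\Phi$ and $\Gamma$, chosen once and for all, such that for all such $X$ and $Y$ some uniform homeomorphism $F:S(X)\to S(Y)$ has modulus of continuity $f=\Phi(\delta_Y,\rho_X)$ while $F^{-1}$ has modulus of continuity $g=\Gamma(\rho_Y,\delta_X)$. -/

import Mathlib

open Topology
open scoped NNReal

/-- The modulus of uniform convexity of a real normed space `E`:
`δ_E(ε) = inf {1 - ‖(x + y) / 2‖ : ‖x‖ = ‖y‖ = 1, ‖x - y‖ ≥ ε}`, meaningful for `0 ≤ ε ≤ 2`.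
For `ε > 2` the set is empty and the value is the constant `0`, for every `E`. -/
noncomputable def convexityModulus (E : Type*) [NormedAddCommGroup E] [NormedSpace ℝ E]
    (ε : ℝ) : ℝ :=
  sInf {r : ℝ | ∃ x y : E, ‖x‖ = 1 ∧ ‖y‖ = 1 ∧ ε ≤ ‖x - y‖ ∧ r = 1 - ‖(1 / 2 : ℝ) • (x + y)‖}

/-- The modulus of uniform smoothness of a real normed space `E`:
`ρ_E(τ) = sup {(‖x + y‖ + ‖x - y‖) / 2 - 1 : ‖x‖ = 1, ‖y‖ = τ}`, meaningful for `τ ≥ 0`.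
For `τ < 0` the set is empty and the value is the constant `0`, for every `E`. -/
noncomputable def smoothnessModulus (E : Type*) [NormedAddCommGroup E] (τ : ℝ) : ℝ :=
  sSup {r : ℝ | ∃ x y : E, ‖x‖ = 1 ∧ ‖y‖ = τ ∧ r = (‖x + y‖ + ‖x - y‖) / 2 - 1}

/-- `E` is uniformly smooth if `ρ_E(τ) / τ → 0` as `τ → 0+`. -/
def IsUniformlySmooth (E : Type*) [NormedAddCommGroup E] : Prop :=
  Filter.Tendsto (fun τ : ℝ => smoothnessModulus E τ / τ) (𝓝[>] 0) (𝓝 0)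

/-- A continuous function `f : [0, ∞) → [0, ∞)` with `f 0 = 0` is a modulus of continuity for a map
`F : A → B` of metric spaces if `d (F a₁) (F a₂) ≤ f (d a₁ a₂)` for all `a₁ a₂`. -/
def IsModulusOfContinuity {A B : Type*} [MetricSpace A] [MetricSpace B]
    (f : ℝ≥0 → ℝ≥0) (F : A → B) : Prop :=
  Continuous f ∧ f 0 = 0 ∧ ∀ a₁ a₂ : A, nndist (F a₁) (F a₂) ≤ f (nndist a₁ a₂)

/-! The unit sphere of each such lattice is carried onto the unit sphere of `ℓ²`, with separate
estimates in the two directions; `F` is the map for `X` followed by the inverse of the map for `Y`.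
Realise `X` as an order ideal in `L¹(μ)`, with `μ` finite. For a unit vector `x` let `q` be the
density of a positive functional of norm at most one norming `|x|`, and put `G x = sign(x) √(q|x|)`,
a unit vector of `L²(μ)`. This is Lozanovskii factorisation followed by the Mazur map.

Smoothness controls `G`. Testing the functionals of `x₁` and `x₂` on `|x₁| ± τz`, with `z` equal to
`|x₂|` up to signs, bounds `‖q₁x₁ - q₂x₂‖₁` through `ρ_X` (`IsSupportDensity.integral_abs_sub_le`),
and the signed square root loses only a power. Convexity controls the inverse. A pointwise
inequality integrates to `2s² ≤ ‖x₁ + x₂‖`, where `s = ⟨G x₁, G x₂⟩ ≥ 0`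
(`IsSupportDensity.two_mul_sq_le_norm_add`), so that `1 - ‖(x₁ + x₂)/2‖ ≤ ‖G x₁ - G x₂‖²`. For
surjectivity, the range of `G` is complete, hence closed, and it is dense because a maximiser of `∫
h log(|x| + ε)` over the positive ball approximately factors a bounded `h ≥ 0`
(`exists_isSupportDensity_approx_of_bounded`).

The representation (`exists_isFunctionRepresentation`) comes from a dense principal ideal, on which
the lattice characters form a compact space and a norming functional becomes a measure. Uniform
convexity makes the norm order continuous, which gives solidity of the image and densities for
positive functionals. `L²(μ)` is `ℓ²` because separability and infinite dimension pass through the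
homeomorphism of spheres.

Chaining the two estimates through `ℓ²` bounds `δ_Y(‖F a - F b‖)` in terms of `ρ_X` and `‖a - b‖`
alone. A modulus is then selected from this relation, which mentions no other datum of the spaces.
-/

open Filter

/-! ### Approximate minimisers in uniformly convex spaces -/

section UniformlyConvex

variable {E : Type*} [NormedAddCommGroup E] [NormedSpace ℝ E] [UniformConvexSpace E]

/-- In a uniformly convex space, a sequence whose norms and midpoint norms tend to the same limit
is Cauchy. -/
theorem cauchySeq_of_tendsto_norm {x : ℕ → E} {b : ℕ → ℝ} {L : ℝ}
    (hx : Tendsto (fun n => ‖x n‖) atTop (𝓝 L)) (hb : Tendsto b atTop (𝓝 L))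
    (h : ∀ n m, n ≤ m → 2 * b n ≤ ‖x n + x m‖) : CauchySeq x := by
  have hL : 0 ≤ L := ge_of_tendsto' hx fun n => norm_nonneg _
  -- Uniform convexity is applied in the ball of radius `L`, which `x n` may leave slightly, so `x
  -- n` is scaled back to a nearby `y n`.
  have key : ∀ n, ∃ y : E, ‖y‖ ≤ L ∧ ‖x n - y‖ ≤ |‖x n‖ - L| := by
    intro n
    rcases le_or_gt ‖x n‖ L with hn | hn
    · exact ⟨x n, hn, by simp⟩
    · have hpos : 0 < ‖x n‖ := hL.trans_lt hn
      refine ⟨(L / ‖x n‖) • x n, ?_, ?_⟩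
      · rw [norm_smul, Real.norm_of_nonneg (by positivity), div_mul_cancel₀ _ hpos.ne']
      · have : x n - (L / ‖x n‖) • x n = (1 - L / ‖x n‖) • x n := by rw [sub_smul, one_smul]
        rw [this, norm_smul, Real.norm_eq_abs, ← abs_of_pos hpos, ← abs_mul, abs_of_pos hpos,
          sub_mul, one_mul, div_mul_cancel₀ _ hpos.ne']
  choose y hy hxy using key
  have he : Tendsto (fun n => |‖x n‖ - L|) atTop (𝓝 0) := by
    simpa using (hx.sub_const L).abs
  rw [Metric.cauchySeq_iff']
  intro ε hε
  obtain ⟨δ, hδ, H⟩ := exists_forall_closed_ball_dist_add_le_two_mul_sub E (half_pos hε) L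
  obtain ⟨N, hN⟩ := ((he.eventually (gt_mem_nhds (show 0 < min (δ / 4) (ε / 4) by positivity))).and
    (hb.eventually (lt_mem_nhds (show L - δ / 4 < L by linarith)))).exists_forall_of_atTop
  refine ⟨N, fun n hn => ?_⟩
  have e1 := (hN N le_rfl).1
  have e2 := (hN n hn).1
  have b1 := (hN N le_rfl).2
  have s1 := h N n hn
  rw [lt_min_iff] at e1 e2
  have t1 : ‖x N + x n‖ ≤ ‖y N + y n‖ + ‖x N - y N‖ + ‖x n - y n‖ := by
    have : x N + x n = (y N + y n) + (x N - y N) + (x n - y n) := by abel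
    rw [this]; exact norm_add₃_le
  have t2 : ‖x n - x N‖ ≤ ‖y N - y n‖ + ‖x N - y N‖ + ‖x n - y n‖ := by
    have : x n - x N = -(y N - y n) + -(x N - y N) + (x n - y n) := by abel
    rw [this]
    refine norm_add₃_le.trans ?_
    rw [norm_neg, norm_neg]
  have hlt : ‖y N - y n‖ < ε / 2 := by
    by_contra hcon
    have := H (hy N) (hy n) (not_lt.1 hcon)
    linarith [hxy N, hxy n]
  rw [dist_eq_norm]
  linarith [hxy N, hxy n]

/-- A decreasing sequence of nonempty bounded closed convex subsets of a uniformly convex Banach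
space has nonempty intersection. -/
theorem exists_mem_forall_of_antitone_convex [CompleteSpace E] {C : ℕ → Set E} (hC : Antitone C)
    (hclosed : ∀ n, IsClosed (C n)) (hconv : ∀ n, Convex ℝ (C n)) (hne : ∀ n, (C n).Nonempty)
    {R : ℝ} (hR : ∀ x ∈ C 0, ‖x‖ ≤ R) : ∃ x, ∀ n, x ∈ C n := by
  set d : ℕ → ℝ := fun n => Metric.infDist 0 (C n) with hd
  have hmono : Monotone d := fun n m hnm => Metric.infDist_le_infDist_of_subset (hC hnm) (hne m)
  have hle : ∀ n, ∀ x ∈ C n, d n ≤ ‖x‖ := fun n x hx => by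
    simpa using Metric.infDist_le_dist_of_mem (x := (0 : E)) hx
  have hbdd : BddAbove (Set.range d) := by
    refine ⟨R, ?_⟩
    rintro _ ⟨n, rfl⟩
    obtain ⟨x, hx⟩ := hne n
    exact (hle n x hx).trans (hR x (hC (Nat.zero_le n) hx))
  have hlim := tendsto_atTop_ciSup hmono hbdd
  have hex : ∀ n : ℕ, ∃ x ∈ C n, ‖x‖ < d n + 1 / ((n : ℝ) + 1) := by
    intro n
    obtain ⟨x, hx, hlt⟩ := (Metric.infDist_lt_iff (hne n)).1
      (show Metric.infDist 0 (C n) < d n + 1 / ((n : ℝ) + 1) by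
        have : (0 : ℝ) < 1 / ((n : ℝ) + 1) := by positivity
        linarith)
    exact ⟨x, hx, by simpa using hlt⟩
  choose x hx hxlt using hex
  have hxlim : Tendsto (fun n => ‖x n‖) atTop (𝓝 (⨆ n, d n)) := by
    refine tendsto_of_tendsto_of_tendsto_of_le_of_le hlim
      (h := fun n => d n + 1 / ((n : ℝ) + 1)) ?_ (fun n => hle n _ (hx n)) fun n => (hxlt n).le
    simpa using hlim.add tendsto_one_div_add_atTop_nhds_zero_nat
  -- For `n ≤ m` the midpoint of `x n` and `x m` lies in the convex set `C n`, so its norm is at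
  -- least `d n`.
  have hcau : CauchySeq x := by
    refine cauchySeq_of_tendsto_norm hxlim hlim fun n m hnm => ?_
    have hmid := hconv n (hx n) (hC hnm (hx m)) (show (0 : ℝ) ≤ 1 / 2 by norm_num)
      (show (0 : ℝ) ≤ 1 / 2 by norm_num) (by norm_num)
    have := hle n _ hmid
    rw [← smul_add, norm_smul] at this
    norm_num at this
    linarith
  obtain ⟨z, hz⟩ := cauchySeq_tendsto_of_complete hcau
  refine ⟨z, fun n => (hclosed n).mem_of_tendsto hz ?_⟩
  filter_upwards [eventually_ge_atTop n] with m hm using hC hm (hx m)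

end UniformlyConvex

/-! ### Order continuity of the norm -/

section BanachLattice

variable {X : Type*} [NormedAddCommGroup X] [Lattice X] [IsOrderedAddMonoid X] [HasSolidNorm X]

theorem norm_le_norm_of_nonneg_of_le {x y : X} (hx : 0 ≤ x) (hxy : x ≤ y) : ‖x‖ ≤ ‖y‖ :=
  norm_le_norm_of_abs_le_abs (by rwa [abs_of_nonneg hx, abs_of_nonneg (hx.trans hxy)])

variable [NormedSpace ℝ X] [UniformConvexSpace X] [CompleteSpace X]

/-- The norms increase to a finite limit, and `x n + x m ≥ 2 x n` for `n ≤ m` keeps the midpoints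
from being shorter than `x n`. Uniform convexity then gives the Cauchy property; this is the source
of all order continuity below. -/
theorem exists_tendsto_of_monotone_of_le {x : ℕ → X} (hx : Monotone x) (h0 : ∀ n, 0 ≤ x n) {y : X}
    (hy : ∀ n, x n ≤ y) : ∃ z, Tendsto x atTop (𝓝 z) := by
  have hmono : Monotone fun n => ‖x n‖ := fun n m hnm =>
    norm_le_norm_of_nonneg_of_le (h0 n) (hx hnm)
  have hbdd : BddAbove (Set.range fun n => ‖x n‖) := by
    refine ⟨‖y‖, ?_⟩
    rintro _ ⟨n, rfl⟩
    exact norm_le_norm_of_nonneg_of_le (h0 n) (hy n)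
  have hlim := tendsto_atTop_ciSup hmono hbdd
  refine cauchySeq_tendsto_of_complete (cauchySeq_of_tendsto_norm hlim hlim fun n m hnm => ?_)
  have : ‖x n + x n‖ ≤ ‖x n + x m‖ :=
    norm_le_norm_of_nonneg_of_le (add_nonneg (h0 n) (h0 n)) (by gcongr; exact hx hnm)
  rwa [← two_smul ℝ (x n), norm_smul, Real.norm_ofNat] at this

theorem exists_tendsto_of_antitone_of_nonneg {x : ℕ → X} (hx : Antitone x) (h0 : ∀ n, 0 ≤ x n) :
    ∃ z, Tendsto x atTop (𝓝 z) := by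
  obtain ⟨z, hz⟩ := exists_tendsto_of_monotone_of_le (x := fun n => x 0 - x n) (y := x 0)
    (fun n m hnm => sub_le_sub_left (hx hnm) _) (fun n => sub_nonneg.2 (hx (Nat.zero_le n)))
    (fun n => sub_le_self _ (h0 n))
  exact ⟨x 0 - z, by simpa using hz.const_sub (x 0)⟩

/-- On an order interval, smallness for a strictly positive functional forces smallness in norm. -/
theorem exists_pos_forall_norm_lt (φ : X →L[ℝ] ℝ)
    (hφ : ∀ x, 0 ≤ x → 0 ≤ φ x) (hφ' : ∀ x, 0 ≤ x → φ x = 0 → x = 0) {x : X} {ε : ℝ}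
    (hε : 0 < ε) : ∃ δ > 0, ∀ w, 0 ≤ w → w ≤ x → φ w < δ → ‖w‖ < ε := by
  by_contra! hcon
  have hmonoφ : ∀ a b : X, a ≤ b → φ a ≤ φ b := fun a b hab => by
    have := hφ _ (sub_nonneg.2 hab)
    rw [map_sub] at this
    linarith
  -- From counterexamples with `φ (w n) < 2⁻ⁿ`, the suprema `z n` of the tails decrease to some `v ≥
  -- 0` with `φ v = 0`. Strict positivity gives `v = 0`, against `ε ≤ ‖w n‖ ≤ ‖z n‖`.
  choose w hw0 hwx hwlt hwε using fun n : ℕ => hcon ((1 / 2) ^ n) (by positivity)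
  -- `s n m` is the supremum of `w n, …, w (n + m)`
  let s : ℕ → ℕ → X := fun n m => partialSups (fun k => w (n + k)) m
  have hs_mono : ∀ n, Monotone (s n) := fun n => (partialSups _).monotone
  have hs_le : ∀ n m, s n m ≤ x := fun n m => partialSups_le _ _ _ fun k _ => hwx _
  have hs_ge : ∀ n m, w (n + m) ≤ s n m := fun n m => le_partialSups (fun k => w (n + k)) m
  have hs0 : ∀ n m, 0 ≤ s n m := fun n m => (hw0 _).trans (hs_ge n m)
  have hs_shift : ∀ n m, s (n + 1) m ≤ s n (m + 1) := fun n m => by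
    refine partialSups_le _ _ _ fun k hk => ?_
    have := le_partialSups_of_le (fun k => w (n + k)) (show k + 1 ≤ m + 1 by omega)
    exact le_trans (le_of_eq (by simp only [add_assoc, add_comm 1 k])) this
  -- The right side is the geometric sum of `2⁻ᵏ` over `n ≤ k ≤ n + m`; the subtracted term is what
  -- lets the induction close.
  have hφs : ∀ n m, φ (s n m) ≤ 2 * (1 / 2) ^ n - (1 / 2) ^ (n + m) := by
    intro n m
    induction m with
    | zero =>
      have : s n 0 = w n := by simp [s]
      rw [this]
      have := hwlt n
      simp only [add_zero]
      linarith
    | succ m ih =>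
      have h1 : s n (m + 1) = s n m ⊔ w (n + (m + 1)) := by simp [s, partialSups_add_one]
      have h2 : s n m ⊔ w (n + (m + 1)) ≤ s n m + w (n + (m + 1)) :=
        sup_le (le_add_of_nonneg_right (hw0 _)) (le_add_of_nonneg_left (hs0 n m))
      have h3 := hmonoφ _ _ h2
      rw [map_add] at h3
      rw [h1]
      have h4 := hwlt (n + (m + 1))
      have h5 : (1 / 2 : ℝ) ^ (n + m) = 2 * (1 / 2) ^ (n + (m + 1)) := by ring
      linarith
  choose z hz using fun n => exists_tendsto_of_monotone_of_le (hs_mono n) (hs0 n) (hs_le n)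
  have hz_ge : ∀ n, w n ≤ z n := fun n =>
    (hs_ge n 0).trans ((hs_mono n).ge_of_tendsto (hz n) 0)
  have hz0 : ∀ n, 0 ≤ z n := fun n => (hw0 n).trans (hz_ge n)
  have hzanti : Antitone z := antitone_nat_of_succ_le fun n =>
    le_of_tendsto_of_tendsto' (hz (n + 1)) ((hz n).comp (tendsto_add_atTop_nat 1)) (hs_shift n)
  obtain ⟨v, hv⟩ := exists_tendsto_of_antitone_of_nonneg hzanti hz0
  have hφz : ∀ n, φ (z n) ≤ 2 * (1 / 2) ^ n := fun n =>
    le_of_tendsto' ((φ.continuous.tendsto _).comp (hz n)) fun m =>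
      (hφs n m).trans (by
        have : (0 : ℝ) ≤ (1 / 2) ^ (n + m) := by positivity
        linarith)
  have hv0 : 0 ≤ v := ge_of_tendsto' hv hz0
  have hφv : φ v = 0 := by
    refine le_antisymm ?_ (hφ v hv0)
    refine le_of_tendsto_of_tendsto' ((φ.continuous.tendsto _).comp hv) ?_ hφz
    simpa using (tendsto_pow_atTop_nhds_zero_of_lt_one (r := (1 / 2 : ℝ)) (by norm_num)
      (by norm_num)).const_mul 2
  have hv' := hφ' v hv0 hφv
  rw [hv'] at hv
  have hnorm : Tendsto (fun n => ‖z n‖) atTop (𝓝 0) := by simpa using hv.norm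
  have : ε ≤ 0 := ge_of_tendsto' hnorm fun n =>
    (hwε n).trans (norm_le_norm_of_nonneg_of_le (hw0 n) (hz_ge n))
  linarith

/-- Convergence in the weak norm `φ |·|` upgrades to convergence in `X` once the differences share
an order bound. This is how limits taken in `L¹` are brought back to `X`. -/
theorem cauchySeq_of_abs_sub_le (φ : X →L[ℝ] ℝ)
    (hφ : ∀ x, 0 ≤ x → 0 ≤ φ x) (hφ' : ∀ x, 0 ≤ x → φ x = 0 → x = 0) {x : X} {w : ℕ → X}
    (hw : ∀ n m, |w n - w m| ≤ x)
    (hc : ∀ ε > 0, ∃ N, ∀ n ≥ N, φ |w n - w N| < ε) : CauchySeq w := by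
  rw [Metric.cauchySeq_iff']
  intro ε hε
  obtain ⟨δ, hδ, H⟩ := exists_pos_forall_norm_lt φ hφ hφ' (x := x) hε
  obtain ⟨N, hN⟩ := hc δ hδ
  refine ⟨N, fun n hn => ?_⟩
  rw [dist_eq_norm, ← norm_abs_eq_norm]
  exact H _ (abs_nonneg _) (hw n N) (hN n hn)

end BanachLattice

/-! ### Principal ideals and lattice characters of order unit spaces -/

section PrincipalIdeal

variable {X : Type*} [NormedAddCommGroup X] [NormedSpace ℝ X] [Lattice X] [IsOrderedAddMonoid X]
  [IsOrderedModule ℝ X]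

/-- The order ideal generated by an element `u`. -/
def principalIdeal (u : X) : Submodule ℝ X where
  carrier := {x | ∃ c : ℝ, |x| ≤ c • u}
  zero_mem' := ⟨0, by simp⟩
  add_mem' := by
    rintro x y ⟨c, hc⟩ ⟨d, hd⟩
    exact ⟨c + d, (abs_add_le x y).trans (by rw [add_smul]; exact add_le_add hc hd)⟩
  smul_mem' := by
    rintro a x ⟨c, hc⟩
    refine ⟨|a| * c, ?_⟩
    have : |a • x| ≤ |a| • |x| := by
      rcases le_total 0 a with ha | ha
      · rw [abs_of_nonneg ha]
        exact abs_le'.2 ⟨smul_le_smul_of_nonneg_left (le_abs_self x) ha,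
          by rw [← smul_neg]; exact smul_le_smul_of_nonneg_left (neg_le_abs x) ha⟩
      · rw [abs_of_nonpos ha]
        refine abs_le'.2 ⟨?_, ?_⟩
        · have := smul_le_smul_of_nonneg_left (neg_le_abs x) (neg_nonneg.2 ha)
          simpa using this
        · have := smul_le_smul_of_nonneg_left (le_abs_self x) (neg_nonneg.2 ha)
          simpa using this
    rw [mul_smul]
    exact this.trans (smul_le_smul_of_nonneg_left hc (abs_nonneg a))

theorem exists_nonneg_abs_le_of_mem_principalIdeal {u x : X} (hu : 0 ≤ u)
    (hx : x ∈ principalIdeal u) : ∃ c : ℝ, 0 ≤ c ∧ |x| ≤ c • u := by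
  obtain ⟨c, hc⟩ := hx
  exact ⟨max c 0, le_max_right _ _, hc.trans (smul_le_smul_of_nonneg_right (le_max_left _ _) hu)⟩

end PrincipalIdeal

section OrderUnit

variable {V : Type*} [AddCommGroup V] [Lattice V] [Module ℝ V]

/-- Sublinear functionals preserving binary suprema. -/
structure IsSupSublinear (q : V → ℝ) : Prop where
  add_le : ∀ x y, q (x + y) ≤ q x + q y
  map_smul : ∀ c : ℝ, 0 < c → ∀ x, q (c • x) = c * q x
  map_sup : ∀ x y, q (x ⊔ y) = max (q x) (q y)

namespace IsSupSublinear

variable {q : V → ℝ}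

theorem map_zero (hq : IsSupSublinear q) : q 0 = 0 := by
  have := hq.map_smul 2 two_pos 0
  rw [smul_zero] at this
  linarith

theorem neg_le (hq : IsSupSublinear q) (x : V) : -q (-x) ≤ q x := by
  have := hq.add_le x (-x)
  rw [add_neg_cancel, hq.map_zero] at this
  linarith

theorem map_smul_nonneg (hq : IsSupSublinear q) {c : ℝ} (hc : 0 ≤ c) (x : V) :
    q (c • x) = c * q x := by
  rcases hc.eq_or_lt with rfl | hc
  · simp [hq.map_zero]
  · exact hq.map_smul c hc x

/-- The difference quotients defining the directional derivative decrease. -/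
theorem antitone_directional (hq : IsSupSublinear q) (x y : V) :
    Antitone fun t : ℝ => q (t • x + y) - t * q x := by
  intro t s hts
  have h1 : s • x + y = (t • x + y) + (s - t) • x := by rw [sub_smul]; abel
  have h2 := hq.add_le (t • x + y) ((s - t) • x)
  rw [← h1, hq.map_smul_nonneg (sub_nonneg.2 hts)] at h2
  simp only
  linarith

theorem bddBelow_directional (hq : IsSupSublinear q) (x y : V) :
    BddBelow (Set.range fun t : ℝ => q (t • x + y) - t * q x) := by
  refine ⟨-q (-y), ?_⟩
  rintro _ ⟨t, rfl⟩
  refine le_trans ?_ (hq.antitone_directional x y (le_max_left t 0))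
  have h := hq.add_le (max t 0 • x + y) (-y)
  rw [add_neg_cancel_right, hq.map_smul_nonneg (le_max_right _ _)] at h
  simp only
  linarith

/-- The directional derivative in the direction `y` at infinity along `x` is again sublinear and
preserves suprema. -/
theorem directional [IsOrderedAddMonoid V] (hq : IsSupSublinear q) (x : V) :
    IsSupSublinear fun y => ⨅ t : ℝ, (q (t • x + y) - t * q x) := by
  have hlim := fun y =>
    tendsto_atTop_ciInf (hq.antitone_directional x y) (hq.bddBelow_directional x y)
  refine ⟨fun y z => ?_, fun c hc y => ?_, fun y z => ?_⟩
  · have h2 : Tendsto (fun t : ℝ => 2 * t) atTop atTop := tendsto_id.const_mul_atTop two_pos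
    refine le_of_tendsto_of_tendsto' ((hlim (y + z)).comp h2) ((hlim y).add (hlim z)) fun t => ?_
    have h := hq.add_le (t • x + y) (t • x + z)
    have e : (2 * t) • x + (y + z) = (t • x + y) + (t • x + z) := by
      rw [two_mul, add_smul]; abel
    simp only [Function.comp_apply, e]
    linarith
  · have h2 : Tendsto (fun t : ℝ => c * t) atTop atTop := tendsto_id.const_mul_atTop hc
    refine tendsto_nhds_unique ((hlim (c • y)).comp h2) (((hlim y).const_mul c).congr fun t => ?_)
    have e : (c * t) • x + c • y = c • (t • x + y) := by rw [smul_add, mul_smul]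
    simp only [Function.comp_apply, e, hq.map_smul c hc]
    ring
  · refine tendsto_nhds_unique (hlim (y ⊔ z)) (((hlim y).max (hlim z)).congr fun t => ?_)
    rw [add_sup, hq.map_sup, max_sub_sub_right]

end IsSupSublinear

/-- Two members of a chain that nearly attain the infimum at `x` and at `y` can be replaced by the
smaller of them, so subadditivity and preservation of suprema survive. The common bound `b` keeps
the infimum finite, since `-b (-x)` lies below every value at `x`. This supplies the lower bounds
for Zorn's lemma. -/
theorem IsChain.isSupSublinear_iInf {c : Set (V → ℝ)} (hc : IsChain (· ≤ ·) c)
    (hne : c.Nonempty) {b : V → ℝ} (h : ∀ p ∈ c, IsSupSublinear p) (hb : ∀ p ∈ c, p ≤ b) :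
    IsSupSublinear (fun x => ⨅ p : c, p.1 x) ∧ ∀ p ∈ c, (fun x => ⨅ p : c, p.1 x) ≤ p := by
  have : Nonempty c := hne.to_subtype
  have hbdd : ∀ x, BddBelow (Set.range fun p : c => p.1 x) := by
    intro x
    refine ⟨-b (-x), ?_⟩
    rintro _ ⟨p, rfl⟩
    have := (h p p.2).neg_le x
    have := hb p p.2 (-x)
    simp only
    linarith
  have hle : ∀ p : c, ∀ x, (⨅ p : c, p.1 x) ≤ p.1 x := fun p x => ciInf_le (hbdd x) p
  have hmin : ∀ p₁ p₂ : c, ∃ p : c, p.1 ≤ p₁.1 ∧ p.1 ≤ p₂.1 := fun p₁ p₂ =>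
    (hc.total p₁.2 p₂.2).elim (fun h => ⟨p₁, le_rfl, h⟩) fun h => ⟨p₂, h, le_rfl⟩
  refine ⟨⟨fun x y => ?_, fun t ht x => ?_, fun x y => ?_⟩, fun p hp x => hle ⟨p, hp⟩ x⟩
  · refine le_of_forall_pos_lt_add fun ε hε => ?_
    obtain ⟨p₁, h₁⟩ := exists_lt_of_ciInf_lt (show (⨅ p : c, p.1 x) < (⨅ p : c, p.1 x) + ε / 2 by
      linarith)
    obtain ⟨p₂, h₂⟩ := exists_lt_of_ciInf_lt (show (⨅ p : c, p.1 y) < (⨅ p : c, p.1 y) + ε / 2 by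
      linarith)
    obtain ⟨p, hp₁, hp₂⟩ := hmin p₁ p₂
    have := hle p (x + y)
    have := (h p p.2).add_le x y
    have := hp₁ x
    have := hp₂ y
    linarith
  · simp only [fun p : c => (h p p.2).map_smul t ht x]
    exact (Real.mul_iInf_of_nonneg ht.le _).symm
  · apply le_antisymm
    · by_contra! hcon
      rw [max_lt_iff] at hcon
      obtain ⟨p₁, h₁⟩ := exists_lt_of_ciInf_lt hcon.1
      obtain ⟨p₂, h₂⟩ := exists_lt_of_ciInf_lt hcon.2
      obtain ⟨p, hp₁, hp₂⟩ := hmin p₁ p₂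
      have h3 := hle p (x ⊔ y)
      rw [(h p p.2).map_sup] at h3
      rcases le_max_iff.1 h3 with h4 | h4
      · linarith [hp₁ x]
      · linarith [hp₂ y]
    · refine le_ciInf fun p => ?_
      rw [(h p p.2).map_sup]
      exact max_le_max (hle p x) (hle p y)

/-- A sublinear functional preserving suprema dominates a linear one that agrees with it at a given
point. -/
theorem IsSupSublinear.exists_linear [IsOrderedAddMonoid V] {q : V → ℝ} (hq : IsSupSublinear q)
    (x : V) : ∃ ψ : V →ₗ[ℝ] ℝ, (∀ y z, ψ (y ⊔ z) = max (ψ y) (ψ z)) ∧ (∀ y, ψ y ≤ q y) ∧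
      ψ x = q x := by
  -- Passing to the directional derivative along `x` secures `q₁ (-x) ≤ -q x`; any linear functional
  -- below `q₁` must then take the value `q x` at `x`.
  set q₁ : V → ℝ := fun y => ⨅ t : ℝ, (q (t • x + y) - t * q x) with hq₁
  have hq₁q : ∀ y, q₁ y ≤ q y := fun y =>
    (ciInf_le (hq.bddBelow_directional x y) 0).trans (by simp)
  have hq₁x : q₁ (-x) ≤ -q x :=
    (ciInf_le (hq.bddBelow_directional x (-x)) 1).trans (by simp [hq.map_zero])
  obtain ⟨m, hm⟩ := zorn_le₀ (α := (V → ℝ)ᵒᵈ)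
    {p | IsSupSublinear (OrderDual.ofDual p) ∧ OrderDual.ofDual p ≤ q₁} (by
      intro c hcs hc
      rcases c.eq_empty_or_nonempty with rfl | hne
      · exact ⟨OrderDual.toDual q₁, ⟨hq.directional x, le_rfl⟩, by simp⟩
      · obtain ⟨h1, h2⟩ := IsChain.isSupSublinear_iInf (c := OrderDual.toDual ⁻¹' c) (b := q₁)
          (fun a ha b hb hab => (hc ha hb hab).symm) hne (fun p hp => (hcs hp).1)
          (fun p hp => (hcs hp).2)
        obtain ⟨p, hp⟩ := hne
        exact ⟨OrderDual.toDual _, ⟨h1, (h2 p hp).trans (hcs hp).2⟩, fun z hz => h2 z hz⟩)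
  set p : V → ℝ := OrderDual.ofDual m with hp
  have hps : IsSupSublinear p := hm.prop.1
  have hpq₁ : p ≤ q₁ := hm.prop.2
  -- The directional derivative of `p` along `y` lies below `p` and is again admissible, so by
  -- minimality it dominates `p`; at `-y` it is at most `-p y`. A sublinear functional that is odd
  -- is linear.
  have hneg : ∀ y, p (-y) = -p y := by
    intro y
    refine le_antisymm ?_ (by linarith [hps.neg_le y])
    have hle : (fun z => ⨅ t : ℝ, (p (t • y + z) - t * p y)) ≤ p := fun z =>
      (ciInf_le (hps.bddBelow_directional y z) 0).trans (by simp)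
    have hmem := hm.2 (y := OrderDual.toDual fun z => ⨅ t : ℝ, (p (t • y + z) - t * p y))
      ⟨hps.directional y, hle.trans hpq₁⟩ hle
    refine (hmem (-y)).trans
      ((ciInf_le (hps.bddBelow_directional y (-y)) 1).trans (by simp [hps.map_zero]))
  have hadd : ∀ y z, p (y + z) = p y + p z := by
    intro y z
    refine le_antisymm (hps.add_le y z) ?_
    have h1 := hps.add_le (-y) (-z)
    rw [← neg_add, hneg, hneg, hneg] at h1
    linarith
  have hsmul : ∀ (c : ℝ) y, p (c • y) = c * p y := by
    intro c y
    rcases le_total 0 c with hc | hc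
    · exact hps.map_smul_nonneg hc y
    · have := hps.map_smul_nonneg (neg_nonneg.2 hc) y
      rw [neg_smul, hneg] at this
      linarith
  refine ⟨{ toFun := p, map_add' := hadd, map_smul' := hsmul }, hps.map_sup,
    fun y => (hpq₁ y).trans (hq₁q y), le_antisymm ((hpq₁ x).trans (hq₁q x)) ?_⟩
  have := hpq₁ (-x)
  rw [hneg] at this
  simp only [LinearMap.coe_mk, AddHom.coe_mk]
  linarith

/-- The gauge `x ↦ inf {c | x ≤ c u}` of an order unit. -/
noncomputable def unitGauge (u : V) (x : V) : ℝ := sInf {c : ℝ | x ≤ c • u}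


variable {u : V}

theorem nonempty_unitGauge (hunit : ∀ x : V, ∃ c : ℝ, |x| ≤ c • u) (x : V) :
    {c : ℝ | x ≤ c • u}.Nonempty :=
  (hunit x).imp fun _ hc => (le_abs_self x).trans hc

/-- The real lattice homomorphisms normalised by `ψ u = 1`. -/
def latticeCharacters (u : V) : Set (V → ℝ) :=
  {ψ | (∀ x y, ψ (x + y) = ψ x + ψ y) ∧ (∀ (c : ℝ) x, ψ (c • x) = c * ψ x) ∧
    (∀ x y, ψ (x ⊔ y) = max (ψ x) (ψ y)) ∧ ψ u = 1}

theorem apply_le_of_mem_latticeCharacters {ψ : V → ℝ} (hψ : ψ ∈ latticeCharacters u) {x : V}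
    {c : ℝ} (hx : x ≤ c • u) : ψ x ≤ c := by
  have h := hψ.2.2.1 x (c • u)
  rw [sup_eq_right.2 hx, hψ.2.1, hψ.2.2.2, mul_one] at h
  exact h ▸ le_max_left _ _

/-- Tychonoff: the characters are a closed subset, for pointwise convergence, of a product of
bounded intervals. -/
theorem isCompact_latticeCharacters (hunit : ∀ x : V, ∃ c : ℝ, |x| ≤ c • u) :
    IsCompact (latticeCharacters u) := by
  choose C hC using hunit
  refine (isCompact_univ_pi fun x => isCompact_Icc (a := -C x) (b := C x)).of_isClosed_subset ?_ ?_
  · refine IsClosed.and ?_ (IsClosed.and ?_ (IsClosed.and ?_ ?_))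
    · simp only [Set.ofPred_forall]
      exact isClosed_iInter fun x => isClosed_iInter fun y =>
        isClosed_eq (by fun_prop) (by fun_prop)
    · simp only [Set.ofPred_forall]
      exact isClosed_iInter fun c => isClosed_iInter fun y =>
        isClosed_eq (by fun_prop) (by fun_prop)
    · simp only [Set.ofPred_forall]
      exact isClosed_iInter fun x => isClosed_iInter fun y =>
        isClosed_eq (by fun_prop) (by fun_prop)
    · exact isClosed_eq (by fun_prop) (by fun_prop)
  · intro ψ hψ x _
    have h1 := apply_le_of_mem_latticeCharacters hψ ((le_abs_self x).trans (hC x))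
    have h2 := apply_le_of_mem_latticeCharacters hψ ((neg_le_abs x).trans (hC x))
    have h3 := hψ.2.1 (-1) x
    rw [neg_one_smul] at h3
    exact ⟨by linarith, h1⟩

/-- The evaluation map from `V` to continuous functions on its lattice characters. -/
def characterEval (u : V) : V →ₗ[ℝ] C(latticeCharacters u, ℝ) where
  toFun x := ⟨fun ψ => ψ.1 x, (continuous_apply x).comp continuous_subtype_val⟩
  map_add' x y := by ext ψ; exact ψ.2.1 x y
  map_smul' c x := by ext ψ; exact ψ.2.2.1 c x

theorem characterEval_apply (x : V) (ψ : latticeCharacters u) : characterEval u x ψ = ψ.1 x := rfl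

theorem characterEval_sup (x y : V) :
    characterEval u (x ⊔ y) = characterEval u x ⊔ characterEval u y := by
  ext ψ
  exact ψ.2.2.2.1 x y

theorem characterEval_unit : characterEval u u = 1 := by
  ext ψ
  exact ψ.2.2.2.2

theorem characterEval_abs (x : V) : characterEval u |x| = |characterEval u x| := by
  rw [abs, characterEval_sup, map_neg]
  rfl

/-- The lattice form of Stone–Weierstrass: the range is a sublattice, and it interpolates arbitrary
values at two points because it contains the constants and separates characters. -/
theorem denseRange_characterEval (hunit : ∀ x : V, ∃ c : ℝ, |x| ≤ c • u) :
    DenseRange (characterEval u) := by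
  have : CompactSpace (latticeCharacters u) :=
    isCompact_iff_compactSpace.1 (isCompact_latticeCharacters hunit)
  rw [DenseRange, dense_iff_closure_eq]
  refine ContinuousMap.sublattice_closure_eq_top _ (Set.range_nonempty _) ?_ ?_ ?_
  · rintro _ ⟨x, rfl⟩ _ ⟨y, rfl⟩
    refine ⟨-(-x ⊔ -y), ?_⟩
    rw [map_neg, characterEval_sup, map_neg, map_neg, neg_sup, neg_neg, neg_neg]
  · rintro _ ⟨x, rfl⟩ _ ⟨y, rfl⟩
    exact ⟨x ⊔ y, characterEval_sup x y⟩
  · intro v a b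
    by_cases hab : a = b
    · subst hab
      exact ⟨_, ⟨v a • u, rfl⟩, by simp [characterEval_unit], by simp [characterEval_unit]⟩
    · obtain ⟨w, hw⟩ : ∃ w, a.1 w ≠ b.1 w := by
        by_contra! hcon
        exact hab (Subtype.ext (funext hcon))
      refine ⟨_, ⟨((v a - v b) / (a.1 w - b.1 w)) • (w - b.1 w • u) + v b • u, rfl⟩, ?_, ?_⟩
      · simp only [map_add, map_smul, map_sub, characterEval_unit, ContinuousMap.add_apply,
          ContinuousMap.smul_apply, ContinuousMap.sub_apply, ContinuousMap.one_apply,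
          characterEval_apply, smul_eq_mul]
        field_simp [sub_ne_zero.2 hw]
        ring
      · simp only [map_add, map_smul, map_sub, characterEval_unit, ContinuousMap.add_apply,
          ContinuousMap.smul_apply, ContinuousMap.sub_apply, ContinuousMap.one_apply,
          characterEval_apply, smul_eq_mul]
        ring

variable [IsOrderedAddMonoid V] [IsOrderedModule ℝ V]

theorem bddBelow_unitGauge (hu : ¬ u ≤ 0) (hunit : ∀ x : V, ∃ c : ℝ, |x| ≤ c • u) (x : V) :
    BddBelow {c : ℝ | x ≤ c • u} := by
  obtain ⟨C, hC⟩ := hunit x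
  refine ⟨-C, fun c hc => ?_⟩
  by_contra! hlt
  have h1 : 0 ≤ c • u + C • u := by
    have := add_le_add (show x ≤ c • u from hc) ((neg_le_abs x).trans hC)
    rwa [add_neg_cancel] at this
  rw [← add_smul] at h1
  have h2 := smul_nonneg (inv_nonneg.2 (show 0 ≤ -(c + C) by linarith)) h1
  rw [smul_smul, inv_neg, neg_mul, inv_mul_cancel₀ (by linarith), neg_smul, one_smul] at h2
  exact hu (neg_nonneg.1 h2)

theorem le_smul_of_unitGauge_lt (h0 : 0 ≤ u) (hunit : ∀ x : V, ∃ c : ℝ, |x| ≤ c • u) {x : V}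
    {c : ℝ} (h : unitGauge u x < c) : x ≤ c • u := by
  obtain ⟨d, hd, hdc⟩ := exists_lt_of_csInf_lt (nonempty_unitGauge hunit x) h
  exact (show x ≤ d • u from hd).trans (smul_le_smul_of_nonneg_right hdc.le h0)

theorem unitGauge_le (hu : ¬ u ≤ 0) (hunit : ∀ x : V, ∃ c : ℝ, |x| ≤ c • u) {x : V}
    {c : ℝ} (h : x ≤ c • u) : unitGauge u x ≤ c :=
  csInf_le (bddBelow_unitGauge hu hunit x) h

theorem isSupSublinear_unitGauge (h0 : 0 ≤ u) (hu : ¬ u ≤ 0)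
    (hunit : ∀ x : V, ∃ c : ℝ, |x| ≤ c • u) : IsSupSublinear (unitGauge u) := by
  have hlt := fun {x : V} {c : ℝ} => le_smul_of_unitGauge_lt h0 hunit (x := x) (c := c)
  have hle := fun {x : V} {c : ℝ} => unitGauge_le hu hunit (x := x) (c := c)
  have hmono : ∀ x y : V, x ≤ y → unitGauge u x ≤ unitGauge u y := fun x y hxy =>
    le_of_forall_gt_imp_ge_of_dense fun c hc => hle (hxy.trans (hlt hc))
  have hsmul : ∀ c : ℝ, 0 < c → ∀ x : V, unitGauge u (c • x) ≤ c * unitGauge u x := by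
    intro c hc x
    rw [← div_le_iff₀' hc]
    refine le_of_forall_gt_imp_ge_of_dense fun d hd => ?_
    rw [div_le_iff₀' hc]
    refine hle ?_
    rw [mul_smul]
    exact smul_le_smul_of_nonneg_left (hlt hd) hc.le
  refine ⟨fun x y => ?_, fun c hc x => le_antisymm (hsmul c hc x) ?_, fun x y => ?_⟩
  · refine le_of_forall_pos_le_add fun ε hε => ?_
    have h1 := hlt (show unitGauge u x < unitGauge u x + ε / 2 by linarith)
    have h2 := hlt (show unitGauge u y < unitGauge u y + ε / 2 by linarith)
    refine hle ((add_le_add h1 h2).trans_eq ?_)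
    rw [← add_smul]
    congr 1
    ring
  · have := hsmul c⁻¹ (inv_pos.2 hc) (c • x)
    rwa [smul_smul, inv_mul_cancel₀ hc.ne', one_smul, inv_mul_eq_div, le_div_iff₀' hc] at this
  · refine le_antisymm (le_of_forall_gt_imp_ge_of_dense fun c hc => ?_)
      (max_le (hmono _ _ le_sup_left) (hmono _ _ le_sup_right))
    rw [max_lt_iff] at hc
    exact hle (sup_le (hlt hc.1) (hlt hc.2))

/-- Characters detect the order: some linear lattice homomorphism below the unit gauge attains the
gauge at `x`, and domination at `u` and `-u` forces its value at `u` to be `1`. The gap `a < b` is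
needed because the infimum in the gauge need not be attained. -/
theorem le_smul_of_forall_latticeCharacters (h0 : 0 ≤ u) (hu : ¬ u ≤ 0)
    (hunit : ∀ x : V, ∃ c : ℝ, |x| ≤ c • u) {x : V} {a b : ℝ}
    (h : ∀ ψ ∈ latticeCharacters u, ψ x ≤ a) (hab : a < b) : x ≤ b • u := by
  obtain ⟨ψ, hsup, hle, hx⟩ := (isSupSublinear_unitGauge h0 hu hunit).exists_linear x
  refine le_smul_of_unitGauge_lt h0 hunit (lt_of_le_of_lt ?_ hab)
  rw [← hx]
  refine h _ ⟨map_add ψ, fun c y => by simp, hsup, le_antisymm ?_ ?_⟩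
  · exact (hle u).trans (unitGauge_le hu hunit (by rw [one_smul]))
  · have := (hle (-u)).trans (unitGauge_le hu hunit (c := -1) (by rw [neg_one_smul]))
    rw [map_neg] at this
    linarith

open MeasureTheory in
/-- A positive functional on an Archimedean order unit space is integration against a regular
measure on the space of lattice characters. -/
theorem exists_measure_latticeCharacters (h0 : 0 ≤ u) (hu : ¬ u ≤ 0)
    (hunit : ∀ x : V, ∃ c : ℝ, |x| ≤ c • u)
    (harch : ∀ x : V, (∀ c : ℝ, 0 < c → x ≤ c • u) → x ≤ 0)
    (φ : V →ₗ[ℝ] ℝ) (hφ : ∀ x, 0 ≤ x → 0 ≤ φ x)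
    [MeasurableSpace (latticeCharacters u)] [BorelSpace (latticeCharacters u)] :
    ∃ μ : Measure (latticeCharacters u), IsFiniteMeasure μ ∧ μ.Regular ∧
      ∀ x, ∫ ψ, ψ.1 x ∂μ = φ x := by
  have hcpt : CompactSpace (latticeCharacters u) :=
    isCompact_iff_compactSpace.1 (isCompact_latticeCharacters hunit)
  have hpos : ∀ x, 0 ≤ characterEval u x → 0 ≤ x := by
    intro x hx
    refine neg_nonpos.1 (harch (-x) fun c hc =>
      le_smul_of_forall_latticeCharacters h0 hu hunit (a := 0) (fun ψ hψ => ?_) hc)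
    have h1 := hψ.2.1 (-1) x
    rw [neg_one_smul] at h1
    have h2 : 0 ≤ ψ x := hx ⟨ψ, hψ⟩
    linarith
  have hinj : Function.Injective (characterEval u) := by
    rw [← LinearMap.ker_eq_bot, LinearMap.ker_eq_bot']
    intro x hx
    refine le_antisymm (neg_nonneg.1 (hpos _ ?_)) (hpos _ hx.ge)
    rw [map_neg, hx, neg_zero]
  let f : C(latticeCharacters u, ℝ) →ₗ.[ℝ] ℝ :=
    { domain := LinearMap.range (characterEval u)
      toFun := φ ∘ₗ (LinearEquiv.ofInjective (characterEval u) hinj).symm.toLinearMap }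
  have hf : ∀ x, f ⟨characterEval u x, LinearMap.mem_range_self _ x⟩ = φ x := by
    intro x
    have : (LinearEquiv.ofInjective (characterEval u) hinj).symm
        ⟨characterEval u x, LinearMap.mem_range_self _ x⟩ = x := by
      rw [LinearEquiv.symm_apply_eq]
      rfl
    exact congrArg φ this
  -- The range of the evaluation map contains the constants, hence majorises every continuous
  -- function, so the positive functional extends to all of them and is represented by a measure.
  obtain ⟨Λ, hΛ, hΛ0⟩ := riesz_extension (PointedCone.positive ℝ C(latticeCharacters u, ℝ)) f
    (by
      rintro ⟨_, x, rfl⟩ hx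
      rw [hf]
      exact hφ x (hpos x hx))
    (by
      intro y
      refine ⟨⟨characterEval u (‖y‖ • u), LinearMap.mem_range_self _ _⟩, ?_⟩
      intro ψ
      have := y.norm_coe_le_norm ψ
      change 0 ≤ ψ.1 (‖y‖ • u) + y ψ
      rw [ψ.2.2.1, ψ.2.2.2.2]
      linarith [neg_abs_le (y ψ), Real.norm_eq_abs (y ψ)])
  let Λ' : CompactlySupportedContinuousMap (latticeCharacters u) ℝ →ₚ[ℝ] ℝ :=
    PositiveLinearMap.mk₀
      { toFun := fun g => Λ g.toContinuousMap
        map_add' := fun g h => Λ.map_add _ _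
        map_smul' := fun c g => Λ.map_smul _ _ } fun g hg => hΛ0 _ hg
  refine ⟨RealRMK.rieszMeasure Λ', ?_, ?_, fun x => ?_⟩
  · infer_instance
  · infer_instance
  · have := RealRMK.integral_rieszMeasure Λ'
      (CompactlySupportedContinuousMap.continuousMapEquiv (characterEval u x))
    refine this.trans ((hΛ ⟨characterEval u x, LinearMap.mem_range_self _ x⟩).trans (hf x))

end OrderUnit

/-! ### Weak units and strictly positive functionals -/

section WeakUnit

variable {X : Type*} [NormedAddCommGroup X] [NormedSpace ℝ X] [Lattice X] [IsOrderedAddMonoid X]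
  [IsOrderedModule ℝ X] [HasSolidNorm X]

-- A weighted sum of the moduli of a dense sequence dominates a positive multiple of each of them,
-- so the whole sequence lies in its ideal.
variable (X) in
theorem exists_dense_principalIdeal [CompleteSpace X] [TopologicalSpace.SeparableSpace X]
    [Nontrivial X] :
    ∃ u : X, 0 ≤ u ∧ ‖u‖ = 1 ∧ Dense (principalIdeal u : Set X) := by
  set s : ℕ → X := TopologicalSpace.denseSeq X with hs
  set c : ℕ → ℝ := fun n => (1 / 2) ^ n * (1 + ‖s n‖)⁻¹ with hc
  have hcpos : ∀ n, 0 < c n := fun n => by positivity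
  have hle : ∀ n, ‖c n • |s n|‖ ≤ (1 / 2) ^ n := by
    intro n
    rw [norm_smul, norm_abs_eq_norm, Real.norm_of_nonneg (hcpos n).le, hc]
    have : (1 + ‖s n‖)⁻¹ * ‖s n‖ ≤ 1 := by
      rw [inv_mul_le_iff₀ (by positivity)]
      linarith
    simp only [mul_assoc]
    exact mul_le_of_le_one_right (by positivity) this
  have hsum : Summable fun n => c n • |s n| :=
    Summable.of_norm_bounded (summable_geometric_of_lt_one (by norm_num) (by norm_num)) hle
  have hnn : ∀ n, 0 ≤ c n • |s n| := fun n => smul_nonneg (hcpos n).le (abs_nonneg _)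
  set v := ∑' n, c n • |s n| with hv
  have hv0 : 0 ≤ v := tsum_nonneg hnn
  have hterm : ∀ n, |s n| ≤ (c n)⁻¹ • v := by
    intro n
    have h := smul_le_smul_of_nonneg_left (hsum.le_tsum n fun m _ => hnn m)
      (inv_nonneg.2 (hcpos n).le)
    rwa [inv_smul_smul₀ (hcpos n).ne'] at h
  have hvne : v ≠ 0 := by
    intro h0
    have hz : ∀ n, s n = 0 := fun n => by
      have := hterm n
      rw [h0, smul_zero] at this
      rw [← norm_eq_zero, ← norm_abs_eq_norm, le_antisymm this (abs_nonneg _), norm_zero]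
    obtain ⟨x, hx⟩ := exists_ne (0 : X)
    have hd : Set.range s ⊆ {0} := by
      rintro _ ⟨n, rfl⟩
      exact hz n
    have := closure_minimal hd isClosed_singleton (TopologicalSpace.denseRange_denseSeq X x)
    exact hx this
  have hvpos : 0 < ‖v‖ := norm_pos_iff.2 hvne
  refine ⟨‖v‖⁻¹ • v, smul_nonneg (inv_nonneg.2 hvpos.le) hv0, ?_, ?_⟩
  · rw [norm_smul, norm_inv, norm_norm, inv_mul_cancel₀ hvpos.ne']
  · refine (TopologicalSpace.denseRange_denseSeq X).mono ?_
    rintro _ ⟨n, rfl⟩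
    refine ⟨(c n)⁻¹ * ‖v‖, ?_⟩
    rw [smul_smul, mul_assoc, mul_inv_cancel₀ hvpos.ne', mul_one]
    exact hterm n

/-- If `0 ≤ y ≤ u` then `‖u - y‖ ≤ 1`, so `1 - φ y ≤ 1`. Scaling covers the moduli of elements of
the ideal and density the rest. -/
theorem nonneg_of_norming_dense {u : X} (hu : ‖u‖ = 1)
    (hu0 : 0 ≤ u) (hd : Dense (principalIdeal u : Set X)) {φ : X →L[ℝ] ℝ} (hφ : ‖φ‖ ≤ 1)
    (hφu : φ u = 1) {x : X} (hx : 0 ≤ x) : 0 ≤ φ x := by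
  have hcl : IsClosed {y : X | 0 ≤ φ |y|} :=
    isClosed_le continuous_const (φ.continuous.comp (by
      unfold abs
      fun_prop))
  have hsub : (principalIdeal u : Set X) ⊆ {y : X | 0 ≤ φ |y|} := by
    intro y hy
    obtain ⟨c, hc0, hc⟩ := exists_nonneg_abs_le_of_mem_principalIdeal hu0 hy
    have hc1 : 0 < c + 1 := by linarith
    have h1 : (c + 1)⁻¹ • |y| ≤ u := by
      rw [inv_smul_le_iff_of_pos hc1]
      exact hc.trans (smul_le_smul_of_nonneg_right (by linarith) hu0)
    have h2 : ‖u - (c + 1)⁻¹ • |y|‖ ≤ 1 :=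
      (norm_le_norm_of_nonneg_of_le (sub_nonneg.2 h1)
        (sub_le_self _ (smul_nonneg (inv_nonneg.2 hc1.le) (abs_nonneg y)))).trans_eq hu
    have h3 : φ (u - (c + 1)⁻¹ • |y|) ≤ 1 :=
      (le_abs_self _).trans ((φ.le_opNorm _).trans (mul_le_one₀ hφ (norm_nonneg _) h2))
    rw [map_sub, hφu, map_smul, smul_eq_mul] at h3
    have h4 : 0 ≤ (c + 1)⁻¹ * φ |y| := by linarith
    exact nonneg_of_mul_nonneg_right h4 (inv_pos.2 hc1)
  have h := hcl.closure_subset_iff.2 hsub (hd x)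
  rwa [Set.mem_ofPred_eq, abs_of_nonneg hx] at h

/-- With `w = x ⊓ u` one has `φ w = 0`, so `u` and `u - w` lie in the unit ball while `φ` forces
their sum to have norm at least `2`; uniform convexity gives `w = 0`. Then `x` is disjoint from the
ideal of `u`, hence by density from itself. -/
theorem eq_zero_of_norming_dense [UniformConvexSpace X] {u : X} (hu : ‖u‖ = 1)
    (hu0 : 0 ≤ u) (hd : Dense (principalIdeal u : Set X)) {φ : X →L[ℝ] ℝ} (hφ : ‖φ‖ ≤ 1)
    (hφu : φ u = 1) {x : X} (hx : 0 ≤ x) (hφx : φ x = 0) : x = 0 := by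
  have hle : ∀ y, φ y ≤ ‖y‖ := fun y =>
    (le_abs_self _).trans ((φ.le_opNorm _).trans (mul_le_of_le_one_left (norm_nonneg _) hφ))
  have hpos := fun {y : X} => nonneg_of_norming_dense hu hu0 hd hφ hφu (x := y)
  have hw0 : 0 ≤ x ⊓ u := le_inf hx hu0
  have hφw : φ (x ⊓ u) = 0 := by
    have h := hpos (sub_nonneg.2 (inf_le_left : x ⊓ u ≤ x))
    rw [map_sub] at h
    exact le_antisymm (by linarith) (hpos hw0)
  have hw : x ⊓ u = 0 := by
    by_contra hne
    obtain ⟨δ, hδ, H⟩ := exists_forall_closed_ball_dist_add_le_two_sub X (norm_pos_iff.2 hne)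
    have h1 : ‖u - x ⊓ u‖ ≤ 1 := by
      rw [← hu]
      exact norm_le_norm_of_nonneg_of_le (sub_nonneg.2 inf_le_right) (sub_le_self _ hw0)
    have h2 := H hu.le h1 (by rw [sub_sub_cancel])
    have h3 := hle (u + (u - x ⊓ u))
    rw [map_add, map_sub, hφu, hφw] at h3
    linarith
  have hcl : IsClosed {y : X | x ⊓ |y| = 0} :=
    isClosed_eq (by unfold abs; fun_prop) continuous_const
  have hsub : (principalIdeal u : Set X) ⊆ {y : X | x ⊓ |y| = 0} := by
    intro y hy
    obtain ⟨c, hc0, hc⟩ := exists_nonneg_abs_le_of_mem_principalIdeal hu0 hy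
    have hc1 : 0 < c + 1 := by linarith
    have ht0 : 0 ≤ x ⊓ |y| := le_inf hx (abs_nonneg y)
    have h1 : (c + 1)⁻¹ • (x ⊓ |y|) ≤ x ⊓ u := by
      refine le_inf ?_ ?_
      · refine (smul_le_of_le_one_left ht0 (inv_le_one_of_one_le₀ (by linarith))).trans inf_le_left
      · rw [inv_smul_le_iff_of_pos hc1]
        exact inf_le_right.trans (hc.trans (smul_le_smul_of_nonneg_right (by linarith) hu0))
    rw [hw, inv_smul_le_iff_of_pos hc1, smul_zero] at h1
    exact le_antisymm h1 ht0
  have h := hcl.closure_subset_iff.2 hsub (hd x)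
  rwa [Set.mem_ofPred_eq, abs_of_nonneg hx, inf_idem] at h

end WeakUnit

section PrincipalIdealLattice

variable {X : Type*} [NormedAddCommGroup X] [NormedSpace ℝ X] [Lattice X] [IsOrderedAddMonoid X]
  [IsOrderedModule ℝ X] {u : X}

theorem principalIdeal_abs_mem {x : X} (hx : x ∈ principalIdeal u) : |x| ∈ principalIdeal u := by
  obtain ⟨c, hc⟩ := hx
  exact ⟨c, by rwa [abs_abs]⟩

theorem principalIdeal_sup_mem {x y : X} (hx : x ∈ principalIdeal u) (hy : y ∈ principalIdeal u) :
    x ⊔ y ∈ principalIdeal u := by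
  rw [sup_eq_half_smul_add_add_abs_sub' ℝ x y]
  exact Submodule.smul_mem _ _ (Submodule.add_mem _ (Submodule.add_mem _ hx hy)
    (principalIdeal_abs_mem (Submodule.sub_mem _ hy hx)))

theorem principalIdeal_inf_mem {x y : X} (hx : x ∈ principalIdeal u) (hy : y ∈ principalIdeal u) :
    x ⊓ y ∈ principalIdeal u := by
  rw [inf_eq_half_smul_add_sub_abs_sub' ℝ x y]
  exact Submodule.smul_mem _ _ (Submodule.sub_mem _ (Submodule.add_mem _ hx hy)
    (principalIdeal_abs_mem (Submodule.sub_mem _ hy hx)))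

instance principalIdealLattice : Lattice (principalIdeal u) :=
  Subtype.lattice (fun _ _ => principalIdeal_sup_mem) fun _ _ => principalIdeal_inf_mem

instance : IsOrderedAddMonoid (principalIdeal u) where
  add_le_add_left _ _ h c := add_le_add_left (α := X) h c

instance : IsOrderedModule ℝ (principalIdeal u) where
  smul_le_smul_of_nonneg_left _ hc _ _ h := smul_le_smul_of_nonneg_left (α := ℝ) (β := X) h hc
  smul_le_smul_of_nonneg_right b hb _ _ h :=
    smul_le_smul_of_nonneg_right (α := ℝ) (β := X) (b := b) h hb

theorem coe_abs_principalIdeal (x : principalIdeal u) :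
    ((|x| : principalIdeal u) : X) = |(x : X)| :=
  rfl

end PrincipalIdealLattice

open MeasureTheory

universe v

/-! ### Representation as an order ideal of `L¹` -/

section FunctionRepresentation

variable {X : Type*} [NormedAddCommGroup X] [NormedSpace ℝ X] [Lattice X]
  {Ω : Type*} [MeasurableSpace Ω] {μ : Measure Ω}

/-- An identification of a Banach lattice with an order ideal of `L¹(μ)` containing the constants,
the element `u` of norm one corresponding to the constant function `1`. -/
structure IsFunctionRepresentation (J : X →L[ℝ] Lp ℝ 1 μ) (u : X) : Prop where
  map_abs : ∀ x, J |x| = |J x|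
  injective : Function.Injective J
  solid : ∀ (x : X) (f : Lp ℝ 1 μ), |f| ≤ J x → ∃ y, J y = f
  norm_unit : ‖u‖ = 1
  map_unit : J u =ᵐ[μ] fun _ => 1

variable [IsOrderedAddMonoid X]

theorem map_sup_of_map_abs {Z : Type*} [AddCommGroup Z] [Lattice Z] [Module ℝ Z]
    [IsOrderedAddMonoid Z] (J : X →ₗ[ℝ] Z) (hJ : ∀ x, J |x| = |J x|) (x y : X) :
    J (x ⊔ y) = J x ⊔ J y := by
  rw [sup_eq_half_smul_add_add_abs_sub' ℝ x y, sup_eq_half_smul_add_add_abs_sub' ℝ (J x) (J y),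
    map_smul, map_add, map_add, hJ, map_sub]

theorem map_inf_of_map_abs {Z : Type*} [AddCommGroup Z] [Lattice Z] [Module ℝ Z]
    [IsOrderedAddMonoid Z] (J : X →ₗ[ℝ] Z) (hJ : ∀ x, J |x| = |J x|) (x y : X) :
    J (x ⊓ y) = J x ⊓ J y := by
  rw [inf_eq_half_smul_add_sub_abs_sub' ℝ x y, inf_eq_half_smul_add_sub_abs_sub' ℝ (J x) (J y),
    map_smul, map_sub, map_add, hJ, map_sub]

/-- A lattice homomorphism to `L¹` with dense range whose norm is given by a strictly positive
functional has solid range. -/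
theorem exists_map_eq_of_abs_le [HasSolidNorm X] [UniformConvexSpace X] [CompleteSpace X]
    {J : X →L[ℝ] Lp ℝ 1 μ} (hJ : ∀ x, J |x| = |J x|) (hd : DenseRange J) {φ : X →L[ℝ] ℝ}
    (hφ : ∀ x, 0 ≤ x → 0 ≤ φ x) (hφ' : ∀ x, 0 ≤ x → φ x = 0 → x = 0)
    (hnorm : ∀ x, ‖J x‖ = φ |x|) {x : X} {f : Lp ℝ 1 μ} (hf : |f| ≤ J x) : ∃ y, J y = f := by
  have hpos : ∀ g : Lp ℝ 1 μ, 0 ≤ g → g ≤ J |x| → ∃ y, J y = g := by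
    intro g hg0 hgx
    have hx0 : 0 ≤ |x| := abs_nonneg x
    obtain ⟨s, hs, hslim⟩ := mem_closure_iff_seq_limit.1 (hd g)
    choose w hw using hs
    -- Truncating to `[0, |x|]` does not change the limit of the images and makes the sequence order
    -- bounded, so that it converges in `X` itself.
    set a : ℕ → X := fun n => (w n ⊔ 0) ⊓ |x| with ha
    have ha0 : ∀ n, 0 ≤ a n := fun n => le_inf le_sup_right hx0
    have hax : ∀ n, a n ≤ |x| := fun n => inf_le_right
    have hJa : ∀ n, J (a n) = (s n ⊔ 0) ⊓ J |x| := by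
      intro n
      have h1 := map_inf_of_map_abs J.toLinearMap hJ (w n ⊔ 0) |x|
      have h2 := map_sup_of_map_abs J.toLinearMap hJ (w n) 0
      simp only [ContinuousLinearMap.coe_coe] at h1 h2
      rw [ha]
      simp only
      rw [h1, h2, hw, map_zero]
    have hlim : Tendsto (fun n => J (a n)) atTop (𝓝 g) := by
      have h1 : Tendsto (fun n => (s n ⊔ 0) ⊓ J |x|) atTop (𝓝 ((g ⊔ 0) ⊓ J |x|)) :=
        (hslim.sup_nhds tendsto_const_nhds).inf_nhds tendsto_const_nhds
      rw [sup_eq_left.2 hg0, inf_eq_left.2 hgx] at h1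
      exact h1.congr fun n => (hJa n).symm
    have hcau : CauchySeq a := by
      refine cauchySeq_of_abs_sub_le φ hφ hφ' (x := |x|) (fun n m => abs_le'.2 ⟨?_, ?_⟩) ?_
      · exact (sub_le_self _ (ha0 m)).trans (hax n)
      · rw [neg_sub]
        exact (sub_le_self _ (ha0 n)).trans (hax m)
      · intro ε hε
        obtain ⟨N, hN⟩ := Metric.cauchySeq_iff'.1 hlim.cauchySeq ε hε
        refine ⟨N, fun n hn => ?_⟩
        rw [← hnorm, map_sub, ← dist_eq_norm]
        exact hN n hn
    obtain ⟨y, hy⟩ := cauchySeq_tendsto_of_complete hcau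
    exact ⟨y, tendsto_nhds_unique ((J.continuous.tendsto y).comp hy) hlim⟩
  have hx : J x ≤ J |x| := by
    rw [hJ]
    exact le_abs_self _
  obtain ⟨y, hy⟩ := hpos (f ⊔ 0) le_sup_right
    (sup_le ((le_abs_self f).trans (hf.trans hx)) ((abs_nonneg f).trans (hf.trans hx)))
  obtain ⟨z, hz⟩ := hpos (-f ⊔ 0) le_sup_right
    (sup_le ((neg_le_abs f).trans (hf.trans hx)) ((abs_nonneg f).trans (hf.trans hx)))
  exact ⟨y - z, by rw [map_sub, hy, hz]; exact posPart_sub_negPart f⟩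

/-- A functional `φ` norming a weak unit `u` is strictly positive. On the ideal of `u` it is
integration over the characters, so evaluation satisfies `‖J x‖₁ = φ |x| ≤ ‖x‖` and extends to `X`
by density. Strict positivity keeps the extension injective. -/
theorem exists_isFunctionRepresentation (X : Type v) [NormedAddCommGroup X] [NormedSpace ℝ X]
    [Lattice X] [IsOrderedAddMonoid X] [IsOrderedModule ℝ X] [HasSolidNorm X] [CompleteSpace X]
    [TopologicalSpace.SeparableSpace X] [UniformConvexSpace X] [Nontrivial X] :
    ∃ (Ω : Type v) (_ : MeasurableSpace Ω) (μ : Measure Ω) (_ : IsFiniteMeasure μ)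
      (J : X →L[ℝ] Lp ℝ 1 μ) (u : X), IsFunctionRepresentation J u := by
  obtain ⟨u, hu0, hu1, hd⟩ := exists_dense_principalIdeal X
  obtain ⟨φ, hφ1, hφu⟩ := exists_dual_vector ℝ u  (fun h => by simp [h] at hu1)
  replace hφu : φ u = 1 := by rw [hφu, hu1]; rfl
  have hpos : ∀ x, 0 ≤ x → 0 ≤ φ x := fun x hx => nonneg_of_norming_dense hu1 hu0 hd hφ1.le hφu hx
  have hstrict : ∀ x, 0 ≤ x → φ x = 0 → x = 0 := fun x hx =>
    eq_zero_of_norming_dense hu1 hu0 hd hφ1.le hφu hx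
  set w : principalIdeal u := ⟨u, 1, by rw [one_smul, abs_of_nonneg hu0]⟩ with hw
  have hunit : ∀ x : principalIdeal u, ∃ c : ℝ, |x| ≤ c • w := fun x => x.2
  have hw0 : 0 ≤ w := hu0
  have hwne : ¬ w ≤ 0 := fun h => by
    have : u = 0 := le_antisymm h hu0
    rw [this, norm_zero] at hu1
    exact zero_ne_one hu1
  have harch : ∀ x : principalIdeal u, (∀ c : ℝ, 0 < c → x ≤ c • w) → x ≤ 0 := by
    intro x hx
    have h1 : Tendsto (fun c : ℝ => c • u) (𝓝[>] 0) (𝓝 ((0 : ℝ) • u)) :=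
      ((continuous_id.smul continuous_const).tendsto (0 : ℝ)).mono_left nhdsWithin_le_nhds
    rw [zero_smul] at h1
    exact ge_of_tendsto (b := (x : X)) h1 (eventually_nhdsWithin_of_forall fun c hc => hx c hc)
  let _ : MeasurableSpace (latticeCharacters w) := borel _
  have : BorelSpace (latticeCharacters w) := ⟨rfl⟩
  have : CompactSpace (latticeCharacters w) :=
    isCompact_iff_compactSpace.1 (isCompact_latticeCharacters hunit)
  obtain ⟨μ, hμ, hreg, hint⟩ := exists_measure_latticeCharacters hw0 hwne hunit harch
    (φ.toLinearMap ∘ₗ (principalIdeal u).subtype) fun x hx => hpos _ hx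
  let J₀ : principalIdeal u →ₗ[ℝ] Lp ℝ 1 μ :=
    (ContinuousMap.toLp (E := ℝ) 1 μ ℝ).toLinearMap ∘ₗ characterEval w
  have hJ₀ : ∀ x, J₀ x =ᵐ[μ] fun ψ => ψ.1 x := fun x =>
    ContinuousMap.coeFn_toLp μ (characterEval w x)
  have hJ₀abs : ∀ x, J₀ |x| = |J₀ x| := by
    intro x
    refine Lp.ext ?_
    filter_upwards [hJ₀ |x|, hJ₀ x, Lp.coeFn_abs (J₀ x)] with ψ h1 h2 h3
    rw [h1, h3, h2]
    exact DFunLike.congr_fun (characterEval_abs x) ψ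
  have hJ₀norm : ∀ x, ‖J₀ x‖ = φ |(x : X)| := by
    intro x
    rw [L1.norm_eq_integral_norm, ← coe_abs_principalIdeal]
    refine Eq.trans (integral_congr_ae ?_) (hint |x|)
    filter_upwards [hJ₀ x] with ψ h1
    rw [h1, Real.norm_eq_abs]
    exact (DFunLike.congr_fun (characterEval_abs x) ψ).symm
  have hbound : ∀ x, ‖J₀ x‖ ≤ 1 * ‖(principalIdeal u).subtype x‖ := by
    intro x
    rw [hJ₀norm, ← hφ1]
    refine (le_abs_self _).trans ((φ.le_opNorm _).trans_eq ?_)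
    rw [norm_abs_eq_norm]
    rfl
  have hde : DenseRange (principalIdeal u).subtype := by
    have : Set.range (principalIdeal u).subtype = (principalIdeal u : Set X) := by simp
    rwa [DenseRange, this]
  let J := J₀.extendOfNorm (principalIdeal u).subtype
  have hJ : ∀ x : principalIdeal u, J x = J₀ x := fun x =>
    LinearMap.extendOfNorm_eq hde ⟨1, hbound⟩ x
  have hcabs : Continuous fun x : X => |x| := by unfold abs; fun_prop
  have hcabs' : Continuous fun x : Lp ℝ 1 μ => |x| := by unfold abs; fun_prop
  have hJabs : ∀ x, J |x| = |J x| := fun x => by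
    refine hd.induction (P := fun x => J |x| = |J x|) (fun y hy => ?_)
      (isClosed_eq (J.continuous.comp hcabs) (hcabs'.comp J.continuous)) x
    have h1 := hJ |⟨y, hy⟩|
    rw [hJ₀abs, ← hJ] at h1
    exact h1
  have hJnorm : ∀ x, ‖J x‖ = φ |x| := fun x => by
    refine hd.induction (P := fun x => ‖J x‖ = φ |x|) (fun y hy => ?_)
      (isClosed_eq J.continuous.norm (φ.continuous.comp hcabs)) x
    have h1 := hJ₀norm ⟨y, hy⟩
    rw [← hJ] at h1
    exact h1
  have hJd : DenseRange J := by
    have h1 : DenseRange J₀ :=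
      (ContinuousMap.toLp_denseRange ℝ μ ℝ (by simp)).comp (denseRange_characterEval hunit)
        (ContinuousMap.toLp (E := ℝ) 1 μ ℝ).continuous
    refine h1.mono ?_
    rintro _ ⟨x, rfl⟩
    exact ⟨x, hJ x⟩
  refine ⟨latticeCharacters w, inferInstance, μ, hμ, J, u, hJabs, ?_, fun x f hf =>
    exists_map_eq_of_abs_le hJabs hJd hpos hstrict hJnorm hf, hu1, ?_⟩
  · rw [injective_iff_map_eq_zero]
    intro x hx
    have h1 := hJnorm x
    rw [hx, norm_zero] at h1
    rw [← norm_eq_zero, ← norm_abs_eq_norm, hstrict _ (abs_nonneg x) h1.symm, norm_zero]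
  · have h1 : J u = J₀ w := hJ w
    rw [h1]
    filter_upwards [hJ₀ w] with ψ h2
    rw [h2, ψ.2.2.2.2]

end FunctionRepresentation

open scoped ENNReal

/-! ### Pointwise calculus and densities of positive functionals -/

namespace IsFunctionRepresentation

section Linear

variable {X : Type*} [NormedAddCommGroup X] [NormedSpace ℝ X]
  {Ω : Type*} [MeasurableSpace Ω] {μ : Measure Ω}

theorem ae_zero (J : X →L[ℝ] Lp ℝ 1 μ) : J 0 =ᵐ[μ] fun _ => 0 := by
  rw [map_zero]
  exact Lp.coeFn_zero ℝ 1 μ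

theorem ae_add (J : X →L[ℝ] Lp ℝ 1 μ) (x y : X) : J (x + y) =ᵐ[μ] fun ω => J x ω + J y ω := by
  rw [map_add]
  exact Lp.coeFn_add _ _

theorem ae_sub (J : X →L[ℝ] Lp ℝ 1 μ) (x y : X) : J (x - y) =ᵐ[μ] fun ω => J x ω - J y ω := by
  rw [map_sub]
  exact Lp.coeFn_sub _ _

theorem ae_smul (J : X →L[ℝ] Lp ℝ 1 μ) (c : ℝ) (x : X) : J (c • x) =ᵐ[μ] fun ω => c * J x ω := by
  rw [map_smul]
  exact Lp.coeFn_smul _ _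

end Linear

variable {X : Type*} [NormedAddCommGroup X] [NormedSpace ℝ X] [Lattice X]
  {Ω : Type*} [MeasurableSpace Ω] {μ : Measure Ω}
  {J : X →L[ℝ] Lp ℝ 1 μ} {u : X}

theorem eq_of_ae_eq (hR : IsFunctionRepresentation J u) {x y : X} (h : J x =ᵐ[μ] J y) : x = y :=
  hR.injective (Lp.ext h)

theorem ae_abs (hR : IsFunctionRepresentation J u) (x : X) :
    J |x| =ᵐ[μ] fun ω => |J x ω| := by
  rw [hR.map_abs]
  exact Lp.coeFn_abs _

/-- Functions dominated by an element of the represented lattice belong to it. -/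
theorem exists_ae_eq (hR : IsFunctionRepresentation J u) {f : Ω → ℝ}
    (hf : AEStronglyMeasurable f μ) {x : X} (h : ∀ᵐ ω ∂μ, |f ω| ≤ J x ω) :
    ∃ y, J y =ᵐ[μ] f := by
  have hint : Integrable f μ := (L1.integrable_coeFn (J x)).mono' hf h
  obtain ⟨y, hy⟩ := hR.solid x (hint.toL1 f) (by
    rw [← Lp.coeFn_le]
    filter_upwards [Lp.coeFn_abs (hint.toL1 f), hint.coeFn_toL1, h] with ω h1 h2 h3
    rw [h1, h2]
    exact h3)
  exact ⟨y, by rw [hy]; exact hint.coeFn_toL1⟩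

theorem exists_ae_eq_indicator (hR : IsFunctionRepresentation J u) {s : Set Ω}
    (hs : MeasurableSet s) : ∃ y, J y =ᵐ[μ] s.indicator fun _ => (1 : ℝ) := by
  refine hR.exists_ae_eq (x := u) (measurable_const.indicator hs).aestronglyMeasurable ?_
  filter_upwards [hR.map_unit] with ω h
  rw [h]
  by_cases hω : ω ∈ s <;> simp [hω]

variable [IsOrderedAddMonoid X]

theorem nonneg_iff (hR : IsFunctionRepresentation J u) {x : X} : 0 ≤ x ↔ ∀ᵐ ω ∂μ, 0 ≤ J x ω := by
  constructor
  · intro h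
    filter_upwards [hR.ae_abs x] with ω hω
    rw [abs_of_nonneg h] at hω
    rw [hω]
    exact abs_nonneg _
  · intro h
    suffices hx : |x| = x by
      rw [← hx]
      exact abs_nonneg x
    refine hR.eq_of_ae_eq ?_
    filter_upwards [hR.ae_abs x, h] with ω h1 h2
    rw [h1, abs_of_nonneg h2]

theorem le_iff (hR : IsFunctionRepresentation J u) {x y : X} :
    x ≤ y ↔ ∀ᵐ ω ∂μ, J x ω ≤ J y ω := by
  rw [← sub_nonneg, hR.nonneg_iff]
  refine eventually_congr ?_
  filter_upwards [ae_sub J y x] with ω h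
  rw [h, sub_nonneg]

variable [HasSolidNorm X]

theorem norm_le_norm (hR : IsFunctionRepresentation J u) {x y : X}
    (h : ∀ᵐ ω ∂μ, |J x ω| ≤ |J y ω|) : ‖x‖ ≤ ‖y‖ := by
  refine norm_le_norm_of_abs_le_abs (hR.le_iff.2 ?_)
  filter_upwards [hR.ae_abs x, hR.ae_abs y, h] with ω h1 h2 h3
  rwa [h1, h2]

variable [CompleteSpace X] [UniformConvexSpace X]

/-- Monotone pointwise convergence implies norm convergence. -/
theorem tendsto_of_monotone (hR : IsFunctionRepresentation J u) {x : ℕ → X} {z : X}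
    (hx : Monotone x) (h0 : ∀ n, 0 ≤ x n) (hz : ∀ n, x n ≤ z)
    (h : ∀ᵐ ω ∂μ, Tendsto (fun n => J (x n) ω) atTop (𝓝 (J z ω))) :
    Tendsto x atTop (𝓝 z) := by
  obtain ⟨y, hy⟩ := exists_tendsto_of_monotone_of_le hx h0 hz
  suffices y = z by rwa [← this]
  refine le_antisymm (le_of_tendsto' hy hz) (hR.le_iff.2 ?_)
  have hle : ∀ n, ∀ᵐ ω ∂μ, J (x n) ω ≤ J y ω := fun n => hR.le_iff.1 (hx.ge_of_tendsto hy n)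
  filter_upwards [h, ae_all_iff.2 hle] with ω h1 h2
  exact le_of_tendsto' h1 h2

/-- The measure induced by a positive functional. -/
theorem exists_measure (hR : IsFunctionRepresentation J u) (ψ : X →L[ℝ] ℝ)
    (hψ : ∀ x, 0 ≤ x → 0 ≤ ψ x) : ∃ ν : Measure Ω, IsFiniteMeasure ν ∧ ν ≪ μ ∧
      ∀ s, MeasurableSet s → ∀ e, J e =ᵐ[μ] s.indicator (fun _ => (1 : ℝ)) →
        ν s = ENNReal.ofReal (ψ e) := by
  choose e he using fun (s : Set Ω) (hs : MeasurableSet s) => hR.exists_ae_eq_indicator hs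
  have he0 : ∀ s hs, 0 ≤ e s hs := fun s hs => hR.nonneg_iff.2 (by
    filter_upwards [he s hs] with ω h
    rw [h]
    exact Set.indicator_nonneg (fun _ _ => zero_le_one) ω)
  let ν : Measure Ω := Measure.ofMeasurable (fun s hs => ENNReal.ofReal (ψ (e s hs)))
    (by
      have : e ∅ MeasurableSet.empty = 0 := hR.eq_of_ae_eq (by
        filter_upwards [he ∅ MeasurableSet.empty, ae_zero J]
          with ω h1 h2
        rw [h1, h2, Set.indicator_empty])
      rw [this, map_zero, ENNReal.ofReal_zero])
    (by
      intro f hf hdisj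
      have hpt : ∀ ω, HasSum (fun i => (f i).indicator (fun _ => (1 : ℝ)) ω)
          ((⋃ i, f i).indicator (fun _ => (1 : ℝ)) ω) := by
        intro ω
        by_cases hω : ω ∈ ⋃ i, f i
        · obtain ⟨i, hi⟩ := Set.mem_iUnion.1 hω
          rw [Set.indicator_of_mem hω]
          have h1 : HasSum (fun j => (f j).indicator (fun _ => (1 : ℝ)) ω)
              ((f i).indicator (fun _ => (1 : ℝ)) ω) :=
            hasSum_single (f := fun j => (f j).indicator (fun _ => (1 : ℝ)) ω) i fun j hj =>
              Set.indicator_of_notMem (fun hj' => Set.disjoint_left.1 (hdisj hj) hj' hi) _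
          rwa [Set.indicator_of_mem hi] at h1
        · rw [Set.indicator_of_notMem hω]
          have : (fun i => (f i).indicator (fun _ => (1 : ℝ)) ω) = fun _ => 0 := funext fun i =>
            Set.indicator_of_notMem (fun hi => hω (Set.mem_iUnion.2 ⟨i, hi⟩)) _
          rw [this]
          exact hasSum_zero
      set S : ℕ → X := fun n => ∑ i ∈ Finset.range n, e (f i) (hf i) with hS
      have hJS : ∀ n, ∀ᵐ ω ∂μ,
          J (S n) ω = ∑ i ∈ Finset.range n, (f i).indicator (fun _ => (1 : ℝ)) ω := by
        intro n
        induction n with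
        | zero =>
          filter_upwards [ae_zero J] with ω h
          simpa [hS] using h
        | succ n ih =>
          filter_upwards [ih, ae_add J (S n) (e (f n) (hf n)), he (f n) (hf n)] with ω h1 h2 h3
          have : S (n + 1) = S n + e (f n) (hf n) := Finset.sum_range_succ _ _
          rw [this, h2, h1, h3, Finset.sum_range_succ]
      -- Countable additivity is order continuity: partial sums of disjoint indicators increase to
      -- the indicator of the union, hence converge in the norm of `X`.
      have hlim : Tendsto S atTop (𝓝 (e _ (MeasurableSet.iUnion hf))) := by
        refine hR.tendsto_of_monotone (monotone_nat_of_le_succ fun n => ?_) (fun n =>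
          Finset.sum_nonneg fun i _ => he0 _ _) (fun n => hR.le_iff.2 ?_) ?_
        · simp only [hS, Finset.sum_range_succ]
          exact le_add_of_nonneg_right (he0 _ _)
        · filter_upwards [hJS n, he _ (MeasurableSet.iUnion hf)] with ω h1 h2
          rw [h1, h2]
          exact sum_le_hasSum _ (fun i _ => Set.indicator_nonneg (fun _ _ => zero_le_one) _) (hpt ω)
        · filter_upwards [ae_all_iff.2 hJS, he _ (MeasurableSet.iUnion hf)] with ω h1 h2
          simp only [h1, h2]
          exact (hpt ω).tendsto_sum_nat
      have hsum : HasSum (fun i => ψ (e (f i) (hf i))) (ψ (e _ (MeasurableSet.iUnion hf))) := by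
        rw [hasSum_iff_tendsto_nat_of_nonneg fun i => hψ _ (he0 _ _)]
        refine ((ψ.continuous.tendsto _).comp hlim).congr fun n => ?_
        simp [hS, map_sum]
      rw [← hsum.tsum_eq, ENNReal.ofReal_tsum_of_nonneg (fun i => hψ _ (he0 _ _)) hsum.summable])
  have hν : ∀ s (hs : MeasurableSet s), ν s = ENNReal.ofReal (ψ (e s hs)) := fun s hs =>
    Measure.ofMeasurable_apply s hs
  refine ⟨ν, ⟨?_⟩, ?_, fun s hs y hy => ?_⟩
  · rw [hν _ MeasurableSet.univ]
    exact ENNReal.ofReal_lt_top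
  · refine Measure.AbsolutelyContinuous.mk fun s hs h0 => ?_
    have : e s hs = 0 := hR.eq_of_ae_eq (by
      filter_upwards [he s hs, ae_zero J,
        measure_eq_zero_iff_ae_notMem.1 h0] with ω h1 h2 h3
      rw [h1, h2, Set.indicator_of_notMem h3])
    rw [hν s hs, this, map_zero, ENNReal.ofReal_zero]
  · rw [hν s hs, hR.eq_of_ae_eq ((he s hs).trans hy.symm)]

/-- The induction on `f` quantifies over `z` inside the motive, since the pieces of `f` are
represented by other elements of `X`; they exist by solidity, being dominated by `J z`. Monotone
limits pass through by order continuity. -/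
theorem lintegral_eq_of_measure (hR : IsFunctionRepresentation J u) {ψ : X →L[ℝ] ℝ}
    (hψ : ∀ x, 0 ≤ x → 0 ≤ ψ x) {ν : Measure Ω} (hac : ν ≪ μ)
    (hν : ∀ s, MeasurableSet s → ∀ e, J e =ᵐ[μ] s.indicator (fun _ => (1 : ℝ)) →
        ν s = ENNReal.ofReal (ψ e)) {f : Ω → ℝ≥0∞} (hf : Measurable f) :
    ∀ z, 0 ≤ z → (∀ᵐ ω ∂μ, ENNReal.ofReal (J z ω) = f ω) →
      ∫⁻ ω, f ω ∂ν = ENNReal.ofReal (ψ z) := by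
  have hex : ∀ {g : Ω → ℝ≥0∞} {z : X}, Measurable g → 0 ≤ z →
      (∀ᵐ ω ∂μ, g ω ≤ ENNReal.ofReal (J z ω)) →
      ∃ y, 0 ≤ y ∧ J y =ᵐ[μ] (fun ω => (g ω).toReal) ∧
        ∀ᵐ ω ∂μ, ENNReal.ofReal (J y ω) = g ω := by
    intro g z hg hz h
    obtain ⟨y, hy⟩ := hR.exists_ae_eq (x := z) hg.ennreal_toReal.aestronglyMeasurable (by
      filter_upwards [h, hR.nonneg_iff.1 hz] with ω h1 h2
      rw [abs_of_nonneg ENNReal.toReal_nonneg]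
      exact ENNReal.toReal_le_of_le_ofReal h2 h1)
    refine ⟨y, hR.nonneg_iff.2 ?_, hy, ?_⟩
    · filter_upwards [hy] with ω h1
      rw [h1]
      exact ENNReal.toReal_nonneg
    · filter_upwards [hy, h] with ω h1 h2
      rw [h1, ENNReal.ofReal_toReal (h2.trans_lt ENNReal.ofReal_lt_top).ne]
  refine Measurable.ennreal_induction (motive := fun f => ∀ z, 0 ≤ z →
    (∀ᵐ ω ∂μ, ENNReal.ofReal (J z ω) = f ω) → ∫⁻ ω, f ω ∂ν = ENNReal.ofReal (ψ z)) ?_ ?_ ?_ hf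
  · intro c s hs z hz h
    obtain ⟨e, he⟩ := hR.exists_ae_eq_indicator hs
    have hzne := hR.nonneg_iff.1 hz
    have hze : z = c.toReal • e := by
      refine hR.eq_of_ae_eq ?_
      filter_upwards [h, he, ae_smul J c.toReal e, hzne] with ω h1 h2 h3 h4
      rw [h3, h2, ← ENNReal.toReal_ofReal h4, h1]
      by_cases hω : ω ∈ s <;> simp [hω]
    have he0 : 0 ≤ e := hR.nonneg_iff.2 (by
      filter_upwards [he] with ω h
      rw [h]
      exact Set.indicator_nonneg (fun _ _ => zero_le_one) ω)
    rw [lintegral_indicator_const hs, hze, map_smul, smul_eq_mul,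
      ENNReal.ofReal_mul ENNReal.toReal_nonneg, ← hν s hs e he]
    -- An infinite value can occur only on a null set, because `J z` is finite.
    by_cases hc : c = ∞
    · have hs0 : ν s = 0 := by
        refine hac (measure_eq_zero_iff_ae_notMem.2 ?_)
        filter_upwards [h] with ω h1 hω
        rw [Set.indicator_of_mem hω, hc] at h1
        exact ENNReal.ofReal_ne_top h1
      rw [hs0, mul_zero, mul_zero]
    · rw [ENNReal.ofReal_toReal hc]
  · intro f g _ hf hg ihf ihg z hz h
    obtain ⟨y, hy0, hy, hy'⟩ := hex hf hz (by
      filter_upwards [h] with ω h1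
      rw [h1]
      exact le_self_add)
    obtain ⟨y', hy'0, hyy, hyy'⟩ := hex hg hz (by
      filter_upwards [h] with ω h1
      rw [h1]
      exact le_add_self)
    have hsum : z = y + y' := by
      refine hR.eq_of_ae_eq ?_
      filter_upwards [h, ae_add J y y', hR.nonneg_iff.1 hz, hy', hyy', hR.nonneg_iff.1 hy0,
        hR.nonneg_iff.1 hy'0] with ω h1 h2 h3 h4 h5 h6 h7
      rw [h2, ← ENNReal.toReal_ofReal h3, h1, Pi.add_apply, ← h4, ← h5,
        ← ENNReal.ofReal_add h6 h7, ENNReal.toReal_ofReal (add_nonneg h6 h7)]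
    simp only [Pi.add_apply]
    rw [lintegral_add_left hf, ihf y hy0 hy', ihg y' hy'0 hyy', hsum, map_add,
      ENNReal.ofReal_add (hψ _ hy0) (hψ _ hy'0)]
  · intro f hf hmono ih z hz h
    have hle : ∀ n, ∀ᵐ ω ∂μ, f n ω ≤ ENNReal.ofReal (J z ω) := fun n => by
      filter_upwards [h] with ω h1
      rw [h1]
      exact le_iSup (fun n => f n ω) n
    choose y hy0 hy hy' using fun n => hex (hf n) hz (hle n)
    have hlim : Tendsto y atTop (𝓝 z) := by
      refine hR.tendsto_of_monotone (fun n m hnm => hR.le_iff.2 ?_) hy0 (fun n => hR.le_iff.2 ?_) ?_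
      · filter_upwards [hy n, hy m, hle m] with ω h1 h2 h3
        rw [h1, h2]
        exact ENNReal.toReal_mono (h3.trans_lt ENNReal.ofReal_lt_top).ne (hmono hnm ω)
      · filter_upwards [hy n, hle n, hR.nonneg_iff.1 hz] with ω h1 h2 h3
        rw [h1]
        exact ENNReal.toReal_le_of_le_ofReal h3 h2
      · filter_upwards [ae_all_iff.2 hy, h, hR.nonneg_iff.1 hz] with ω h1 h2 h3
        simp only [h1]
        have h4 := tendsto_atTop_iSup fun n m (hnm : n ≤ m) => hmono hnm ω
        rw [← h2] at h4
        have h5 := (ENNReal.tendsto_toReal ENNReal.ofReal_ne_top).comp h4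
        rwa [ENNReal.toReal_ofReal h3] at h5
    rw [lintegral_iSup hf hmono]
    refine tendsto_nhds_unique (tendsto_atTop_iSup fun n m hnm => lintegral_mono (hmono hnm)) ?_
    simp only [ih _ _ (hy0 _) (hy' _)]
    exact ENNReal.tendsto_ofReal ((ψ.continuous.tendsto z).comp hlim)

/-- Positive functionals are given by integration against a nonnegative density. -/
theorem exists_density [IsFiniteMeasure μ] (hR : IsFunctionRepresentation J u) (ψ : X →L[ℝ] ℝ)
    (hψ : ∀ x, 0 ≤ x → 0 ≤ ψ x) : ∃ q : Ω → ℝ, Measurable q ∧ (∀ ω, 0 ≤ q ω) ∧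
      ∀ z, Integrable (fun ω => q ω * J z ω) μ ∧ ∫ ω, q ω * J z ω ∂μ = ψ z := by
  obtain ⟨ν, hfin, hac, hν⟩ := hR.exists_measure ψ hψ
  have hfinite : ∀ᵐ ω ∂μ, ν.rnDeriv μ ω < ∞ := Measure.rnDeriv_lt_top ν μ
  have hq : Measurable fun ω => (ν.rnDeriv μ ω).toReal :=
    (Measure.measurable_rnDeriv ν μ).ennreal_toReal
  refine ⟨fun ω => (ν.rnDeriv μ ω).toReal, hq, fun ω => ENNReal.toReal_nonneg, ?_⟩
  have hpos : ∀ z, 0 ≤ z → Integrable (fun ω => (ν.rnDeriv μ ω).toReal * J z ω) μ ∧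
      ∫ ω, (ν.rnDeriv μ ω).toReal * J z ω ∂μ = ψ z := by
    intro z hz
    have hz' := hR.nonneg_iff.1 hz
    have hsm : StronglyMeasurable (J z) := Lp.stronglyMeasurable _
    have hmeas : AEStronglyMeasurable (fun ω => (ν.rnDeriv μ ω).toReal * J z ω) μ :=
      (hq.mul hsm.measurable).aestronglyMeasurable
    have hnn : 0 ≤ᵐ[μ] fun ω => (ν.rnDeriv μ ω).toReal * J z ω := by
      filter_upwards [hz'] with ω h
      exact mul_nonneg ENNReal.toReal_nonneg h
    have hl : ∫⁻ ω, ENNReal.ofReal ((ν.rnDeriv μ ω).toReal * J z ω) ∂μ =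
        ENNReal.ofReal (ψ z) := by
      rw [← hR.lintegral_eq_of_measure hψ hac hν hsm.measurable.ennreal_ofReal z hz
        (Eventually.of_forall fun _ => rfl)]
      -- Radon–Nikodym: the measure induced by `ψ` is absolutely continuous, and its derivative is
      -- the required density.
      conv_rhs => rw [← Measure.withDensity_rnDeriv_eq ν μ hac]
      rw [lintegral_withDensity_eq_lintegral_mul _ (Measure.measurable_rnDeriv ν μ)
        hsm.measurable.ennreal_ofReal]
      refine lintegral_congr_ae ?_
      filter_upwards [hfinite] with ω h
      rw [Pi.mul_apply, ENNReal.ofReal_mul ENNReal.toReal_nonneg, ENNReal.ofReal_toReal h.ne]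
    refine ⟨(lintegral_ofReal_ne_top_iff_integrable hmeas hnn).1 ?_, ?_⟩
    · rw [hl]
      exact ENNReal.ofReal_ne_top
    · rw [integral_eq_lintegral_of_nonneg_ae hnn hmeas, hl, ENNReal.toReal_ofReal (hψ z hz)]
  intro z
  obtain ⟨i1, e1⟩ := hpos (z⁺) (posPart_nonneg z)
  obtain ⟨i2, e2⟩ := hpos (z⁻) (negPart_nonneg z)
  have hae : (fun ω => (ν.rnDeriv μ ω).toReal * J z⁺ ω - (ν.rnDeriv μ ω).toReal * J z⁻ ω) =ᵐ[μ]
      fun ω => (ν.rnDeriv μ ω).toReal * J z ω := by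
    filter_upwards [ae_sub J z⁺ z⁻] with ω h
    rw [posPart_sub_negPart] at h
    rw [h, mul_sub]
  refine ⟨(i1.sub i2).congr hae, ?_⟩
  rw [← integral_congr_ae hae, integral_sub i1 i2, e1, e2, ← map_sub, posPart_sub_negPart]

end IsFunctionRepresentation

/-! ### Pointwise inequalities for the signed square root -/

section SignedSqrt

/-- The signed square root `sign t * √|t|`. -/
noncomputable def signedSqrt (t : ℝ) : ℝ := √t - √(-t)

theorem continuous_signedSqrt : Continuous signedSqrt := by
  unfold signedSqrt
  fun_prop

theorem signedSqrt_of_nonneg {t : ℝ} (ht : 0 ≤ t) : signedSqrt t = √t := by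
  rw [signedSqrt, Real.sqrt_eq_zero_of_nonpos (neg_nonpos.2 ht), sub_zero]

theorem signedSqrt_neg (t : ℝ) : signedSqrt (-t) = -signedSqrt t := by
  simp [signedSqrt]

theorem signedSqrt_mul {p : ℝ} (hp : 0 ≤ p) (t : ℝ) : signedSqrt (p * t) = √p * signedSqrt t := by
  rw [signedSqrt, signedSqrt, Real.sqrt_mul hp, ← mul_neg, Real.sqrt_mul hp, mul_sub]

theorem sq_signedSqrt (t : ℝ) : signedSqrt t ^ 2 = |t| := by
  rcases le_total 0 t with h | h
  · rw [signedSqrt_of_nonneg h, Real.sq_sqrt h, abs_of_nonneg h]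
  · have h' := neg_nonneg.2 h
    rw [← neg_neg (signedSqrt t), ← signedSqrt_neg, neg_sq, signedSqrt_of_nonneg h',
      Real.sq_sqrt h', abs_of_nonpos h]

theorem signedSqrt_mul_abs (t : ℝ) : signedSqrt (t * |t|) = t := by
  rcases le_total 0 t with h | h
  · rw [abs_of_nonneg h, signedSqrt_of_nonneg (mul_nonneg h h), Real.sqrt_mul_self h]
  · have h' := neg_nonneg.2 h
    rw [abs_of_nonpos h, ← neg_neg (t * -t), signedSqrt_neg, ← neg_mul,
      signedSqrt_of_nonneg (mul_nonneg h' h'), Real.sqrt_mul_self h', neg_neg]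

/-- For equal signs `|√a - √b| ≤ √a + √b` already gives the bound `|a - b|`; the factor `2` is
needed only for opposite signs, where `(√a + √(-b))² ≤ 2(a - b)`. -/
theorem sq_signedSqrt_sub_le (a b : ℝ) :
    (signedSqrt a - signedSqrt b) ^ 2 ≤ 2 * |a - b| := by
  have key : ∀ a b : ℝ, 0 ≤ a → (signedSqrt a - signedSqrt b) ^ 2 ≤ 2 * |a - b| := by
    intro a b ha
    rcases le_total 0 b with hb | hb
    · rw [signedSqrt_of_nonneg ha, signedSqrt_of_nonneg hb]
      have h1 := Real.sqrt_nonneg a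
      have h2 := Real.sqrt_nonneg b
      have h3 := Real.sq_sqrt ha
      have h4 := Real.sq_sqrt hb
      have h5 : |a - b| = |√a - √b| * (√a + √b) := by
        rw [← abs_of_nonneg (add_nonneg h1 h2), ← abs_mul]
        congr 1
        nlinarith
      have h6 : |√a - √b| ≤ √a + √b := abs_le.2 ⟨by linarith, by linarith⟩
      rw [← sq_abs, h5]
      nlinarith [abs_nonneg (√a - √b)]
    · have hb' := neg_nonneg.2 hb
      rw [signedSqrt_of_nonneg ha, ← neg_neg (signedSqrt b), ← signedSqrt_neg,
        signedSqrt_of_nonneg hb', abs_of_nonneg (by linarith)]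
      nlinarith [sq_nonneg (√a - √(-b)), Real.sq_sqrt ha, Real.sq_sqrt hb']
  rcases le_total 0 a with ha | ha
  · exact key a b ha
  · have h := key (-a) (-b) (neg_nonneg.2 ha)
    rw [signedSqrt_neg, signedSqrt_neg] at h
    have e : |(-a) - (-b)| = |a - b| := by rw [← abs_neg]; congr 1; ring
    rw [e] at h
    linarith [h,
      show (-signedSqrt a - -signedSqrt b) ^ 2 = (signedSqrt a - signedSqrt b) ^ 2 by ring]

/-- For equal signs, expand the squares of `√(pa) - s√(qb)` and `√(pb) - s√(qa)` and add. For
opposite signs the left side is not positive. The weight `s` is left free so that it can later be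
the integral being estimated. -/
theorem four_mul_signedSqrt_mul_le {p q s : ℝ} (hp : 0 ≤ p) (hq : 0 ≤ q) (hs : 0 ≤ s) (a b : ℝ) :
    4 * s * (signedSqrt (p * a) * signedSqrt (q * b)) ≤
      p * |a + b| + s ^ 2 * (q * |a| + q * |b|) := by
  have key : ∀ a b : ℝ, 0 ≤ a → 4 * s * (signedSqrt (p * a) * signedSqrt (q * b)) ≤
      p * |a + b| + s ^ 2 * (q * |a| + q * |b|) := by
    intro a b ha
    rcases le_total 0 b with hb | hb
    · rw [signedSqrt_mul hp, signedSqrt_mul hq, signedSqrt_of_nonneg ha, signedSqrt_of_nonneg hb,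
        abs_of_nonneg ha, abs_of_nonneg hb, abs_of_nonneg (add_nonneg ha hb)]
      have h1 := Real.sq_sqrt hp
      have h2 := Real.sq_sqrt hq
      have h3 := Real.sq_sqrt ha
      have h4 := Real.sq_sqrt hb
      have h5 := sq_nonneg (√p * √a - s * (√q * √b))
      have h6 := sq_nonneg (√p * √b - s * (√q * √a))
      have e : (√p * √a - s * (√q * √b)) ^ 2 + (√p * √b - s * (√q * √a)) ^ 2 =
          √p ^ 2 * (√a ^ 2 + √b ^ 2) + s ^ 2 * (√q ^ 2 * √a ^ 2 + √q ^ 2 * √b ^ 2) -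
            4 * s * (√p * √a * (√q * √b)) := by ring
      rw [h1, h2, h3, h4] at e
      linarith
    · have h1 : 0 ≤ p * |a + b| + s ^ 2 * (q * |a| + q * |b|) := by positivity
      have hb' := neg_nonneg.2 hb
      have h2 : signedSqrt (q * b) = -√(q * -b) := by
        rw [← neg_neg (q * b), signedSqrt_neg, ← mul_neg,
          signedSqrt_of_nonneg (mul_nonneg hq hb')]
      rw [h2, signedSqrt_of_nonneg (mul_nonneg hp ha)]
      have h3 : 0 ≤ 4 * s * (√(p * a) * √(q * -b)) := by positivity
      linarith
  rcases le_total 0 a with ha | ha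
  · exact key a b ha
  · have h := key (-a) (-b) (neg_nonneg.2 ha)
    rw [mul_neg, mul_neg, signedSqrt_neg, signedSqrt_neg, neg_mul_neg, abs_neg, abs_neg,
      ← neg_add, abs_neg] at h
    exact h

end SignedSqrt

/-! ### Support densities and the two estimates -/

section Smoothness

theorem norm_add_add_norm_sub_le {E : Type*} [NormedAddCommGroup E] {x y : E} {τ : ℝ}
    (hx : ‖x‖ = 1) (hy : ‖y‖ = τ) : ‖x + y‖ + ‖x - y‖ ≤ 2 + 2 * smoothnessModulus E τ := by
  have h : (‖x + y‖ + ‖x - y‖) / 2 - 1 ≤ smoothnessModulus E τ := by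
    -- The triangle inequality bounds the set by `τ`, so the supremum is genuine rather than the
    -- default value.
    refine le_csSup ⟨τ, ?_⟩ ⟨x, y, hx, hy, rfl⟩
    rintro _ ⟨x, y, hx, hy, rfl⟩
    have h1 := norm_add_le x y
    have h2 := norm_sub_le x y
    linarith
  linarith

end Smoothness

section SupportDensity

variable {X : Type*} [NormedAddCommGroup X] [NormedSpace ℝ X]
  {Ω : Type*} [MeasurableSpace Ω] {μ : Measure Ω}

/-- `q` is the density of a positive functional of norm at most one that norms `|x|`. -/
structure IsSupportDensity (J : X →L[ℝ] Lp ℝ 1 μ) (x : X) (q : Ω → ℝ) : Prop where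
  measurable : Measurable q
  nonneg : ∀ ω, 0 ≤ q ω
  integrable : ∀ y, Integrable (fun ω => q ω * J y ω) μ
  integral_le : ∀ y, ∫ ω, q ω * J y ω ∂μ ≤ ‖y‖
  integral_abs : ∫ ω, |q ω * J x ω| ∂μ = 1

namespace IsSupportDensity

open IsFunctionRepresentation

variable {J : X →L[ℝ] Lp ℝ 1 μ} {u x x₁ x₂ : X} {q q₁ q₂ : Ω → ℝ}

theorem integral_add (h : IsSupportDensity J x q) (y z : X) :
    ∫ ω, q ω * J (y + z) ω ∂μ = ∫ ω, q ω * J y ω ∂μ + ∫ ω, q ω * J z ω ∂μ := by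
  rw [← MeasureTheory.integral_add (h.integrable y) (h.integrable z)]
  refine integral_congr_ae ?_
  filter_upwards [ae_add J y z] with ω hω
  rw [hω, mul_add]

theorem integral_sub (h : IsSupportDensity J x q) (y z : X) :
    ∫ ω, q ω * J (y - z) ω ∂μ = ∫ ω, q ω * J y ω ∂μ - ∫ ω, q ω * J z ω ∂μ := by
  rw [← MeasureTheory.integral_sub (h.integrable y) (h.integrable z)]
  refine integral_congr_ae ?_
  filter_upwards [ae_sub J y z] with ω hω
  rw [hω, mul_sub]

theorem integral_smul (_h : IsSupportDensity J x q) (c : ℝ) (y : X) :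
    ∫ ω, q ω * J (c • y) ω ∂μ = c * ∫ ω, q ω * J y ω ∂μ := by
  rw [← integral_const_mul]
  refine integral_congr_ae ?_
  filter_upwards [ae_smul J c y] with ω hω
  rw [hω]
  ring

theorem memLp (h : IsSupportDensity J x q) : MemLp (fun ω => signedSqrt (q ω * J x ω)) 2 μ := by
  have hm : AEStronglyMeasurable (fun ω => signedSqrt (q ω * J x ω)) μ :=
    continuous_signedSqrt.comp_aestronglyMeasurable (h.integrable x).1
  rw [memLp_two_iff_integrable_sq hm]
  simp only [sq_signedSqrt]
  exact (h.integrable x).abs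

variable [Lattice X]

theorem ae_mul_abs (h : IsSupportDensity J x q) (hR : IsFunctionRepresentation J u) (y : X) :
    (fun ω => q ω * J |y| ω) =ᵐ[μ] fun ω => |q ω * J y ω| := by
  filter_upwards [hR.ae_abs y] with ω hω
  rw [hω, abs_mul, abs_of_nonneg (h.nonneg ω)]

variable [IsOrderedAddMonoid X] [HasSolidNorm X]

theorem integral_abs_le (h : IsSupportDensity J x q) (hR : IsFunctionRepresentation J u) (y : X) :
    ∫ ω, |q ω * J y ω| ∂μ ≤ ‖y‖ := by
  rw [← integral_congr_ae (h.ae_mul_abs hR y), ← norm_abs_eq_norm]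
  exact h.integral_le _

/-- Uniform continuity of `x ↦ q * J x`, where `q` is a support density of `x`. -/
theorem integral_abs_sub_le (hR : IsFunctionRepresentation J u) (h₁ : IsSupportDensity J x₁ q₁)
    (h₂ : IsSupportDensity J x₂ q₂) (hx₁ : ‖x₁‖ = 1) (hx₂ : ‖x₂‖ = 1) {τ : ℝ} (hτ : 0 < τ) :
    ∫ ω, |q₁ ω * J x₁ ω - q₂ ω * J x₂ ω| ∂μ ≤
      ‖x₁ - x₂‖ + (2 * smoothnessModulus X τ + ‖x₁ - x₂‖) / τ := by
  -- The sign of `q₁ - q₂` is put on `|x₂|`, giving a unit vector `z` with `∫ (q₁ - q₂) z = ∫ |q₁ -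
  -- q₂| |x₂|`.
  have hσ : Measurable fun ω => if q₂ ω ≤ q₁ ω then (1 : ℝ) else -1 :=
    Measurable.ite (measurableSet_le h₂.measurable h₁.measurable) measurable_const measurable_const
  have habs : ∀ ω, |if q₂ ω ≤ q₁ ω then (1 : ℝ) else -1| = 1 := fun ω => by split_ifs <;> simp
  obtain ⟨z, hz⟩ := hR.exists_ae_eq
    (f := fun ω => (if q₂ ω ≤ q₁ ω then (1 : ℝ) else -1) * |J x₂ ω|) (x := |x₂|)
    (hσ.aestronglyMeasurable.mul (L1.integrable_coeFn (J x₂)).1.norm) (by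
      filter_upwards [hR.ae_abs x₂] with ω h
      rw [abs_mul, habs, one_mul, abs_abs, h])
  have hzx : ∀ᵐ ω ∂μ, |J z ω| = |J x₂ ω| := by
    filter_upwards [hz] with ω h
    rw [h, abs_mul, habs, one_mul, abs_abs]
  have hznorm : ‖z‖ = 1 := by
    rw [← hx₂]
    exact le_antisymm (hR.norm_le_norm (hzx.mono fun ω h => h.le))
      (hR.norm_le_norm (hzx.mono fun ω h => h.ge))
  have hτz : ‖τ • z‖ = τ := by rw [norm_smul, hznorm, Real.norm_of_nonneg hτ.le, mul_one]
  have hle : ∫ ω, |q₁ ω * J x₁ ω - q₂ ω * J x₂ ω| ∂μ ≤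
      ∫ ω, |q₁ ω * J (x₁ - x₂) ω| ∂μ + (∫ ω, q₁ ω * J z ω ∂μ - ∫ ω, q₂ ω * J z ω ∂μ) := by
    have iz : Integrable (fun ω => q₁ ω * J z ω - q₂ ω * J z ω) μ :=
      (h₁.integrable z).sub (h₂.integrable z)
    rw [← MeasureTheory.integral_sub (h₁.integrable z) (h₂.integrable z),
      ← MeasureTheory.integral_add (h₁.integrable _).abs iz]
    refine integral_mono_ae ((h₁.integrable _).sub (h₂.integrable _)).abs
      ((h₁.integrable _).abs.add iz) ?_
    filter_upwards [hz, ae_sub J x₁ x₂] with ω e1 e2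
    simp only [e1, e2]
    have e3 : q₁ ω * ((if q₂ ω ≤ q₁ ω then (1 : ℝ) else -1) * |J x₂ ω|) -
        q₂ ω * ((if q₂ ω ≤ q₁ ω then (1 : ℝ) else -1) * |J x₂ ω|) = |(q₁ ω - q₂ ω) * J x₂ ω| := by
      rw [abs_mul]
      split_ifs with hq
      · rw [abs_of_nonneg (sub_nonneg.2 hq)]
        ring
      · rw [abs_of_nonpos (show q₁ ω - q₂ ω ≤ 0 by linarith)]
        ring
    rw [e3]
    refine le_trans (le_of_eq ?_) (abs_add_le _ _)
    congr 1
    ring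
  have hA := h₁.integral_abs_le hR (x₁ - x₂)
  have hI₁ : ∫ ω, q₁ ω * J |x₁| ω ∂μ = 1 :=
    (integral_congr_ae (h₁.ae_mul_abs hR x₁)).trans h₁.integral_abs
  have hI₂ : ∫ ω, q₂ ω * J |x₂| ω ∂μ = 1 :=
    (integral_congr_ae (h₂.ae_mul_abs hR x₂)).trans h₂.integral_abs
  -- The first functional is tested on `|x₁| + τz` and the second on `|x₁| - τz`. Their sum falls
  -- under `ρ_X(τ)`, and replacing `|x₁|` by `|x₂|` in the second costs at most `‖x₁ - x₂‖`.
  have b1 := h₁.integral_le (|x₁| + τ • z)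
  rw [h₁.integral_add, h₁.integral_smul, hI₁] at b1
  have b2 := h₂.integral_le (|x₁| - τ • z)
  rw [h₂.integral_sub, h₂.integral_smul] at b2
  have b3 := h₂.integral_le (|x₂| - |x₁|)
  rw [h₂.integral_sub, hI₂] at b3
  have b4 : ‖|x₂| - |x₁|‖ ≤ ‖x₁ - x₂‖ := by
    rw [norm_sub_rev x₁]
    exact norm_abs_sub_abs _ _
  have b5 := norm_add_add_norm_sub_le (by rwa [norm_abs_eq_norm] : ‖|x₁|‖ = 1) hτz
  have hB : ∫ ω, q₁ ω * J z ω ∂μ - ∫ ω, q₂ ω * J z ω ∂μ ≤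
      (2 * smoothnessModulus X τ + ‖x₁ - x₂‖) / τ := by
    rw [le_div_iff₀ hτ]
    linarith
  linarith

/-- Integrating the pointwise inequality with weight equal to the inner product `s` gives `4s² ≤ ‖x₁
+ x₂‖ + s²(1 + 1)`, because the second density integrates both `|x₁|` and `|x₂|` to at most `1`. -/
theorem two_mul_sq_le_norm_add (hR : IsFunctionRepresentation J u) (h₁ : IsSupportDensity J x₁ q₁)
    (h₂ : IsSupportDensity J x₂ q₂) (hx₁ : ‖x₁‖ = 1) {s : ℝ} (hs : 0 ≤ s)
    (hsI : s = ∫ ω, signedSqrt (q₁ ω * J x₁ ω) * signedSqrt (q₂ ω * J x₂ ω) ∂μ) :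
    2 * s ^ 2 ≤ ‖x₁ + x₂‖ := by
  have hint : Integrable (fun ω => signedSqrt (q₁ ω * J x₁ ω) * signedSqrt (q₂ ω * J x₂ ω)) μ :=
    h₁.memLp.integrable_mul h₂.memLp
  have i1 := (h₁.integrable (x₁ + x₂)).abs
  have i2 := (h₂.integrable x₁).abs
  have i3 := (h₂.integrable x₂).abs
  have i4 : Integrable (fun ω => s ^ 2 * (|q₂ ω * J x₁ ω| + |q₂ ω * J x₂ ω|)) μ :=
    (i2.add i3).const_mul _
  have hle : ∫ ω, 4 * s * (signedSqrt (q₁ ω * J x₁ ω) * signedSqrt (q₂ ω * J x₂ ω)) ∂μ ≤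
      ∫ ω, (|q₁ ω * J (x₁ + x₂) ω| + s ^ 2 * (|q₂ ω * J x₁ ω| + |q₂ ω * J x₂ ω|)) ∂μ := by
    refine integral_mono_ae (hint.const_mul _) (i1.add i4) ?_
    filter_upwards [ae_add J x₁ x₂] with ω hω
    have := four_mul_signedSqrt_mul_le (h₁.nonneg ω) (h₂.nonneg ω) hs (J x₁ ω) (J x₂ ω)
    simpa only [hω, abs_mul, abs_of_nonneg (h₁.nonneg ω), abs_of_nonneg (h₂.nonneg ω)] using this
  rw [integral_const_mul, ← hsI, MeasureTheory.integral_add i1 i4,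
    integral_const_mul, MeasureTheory.integral_add i2 i3, h₂.integral_abs] at hle
  have b1 := h₁.integral_abs_le hR (x₁ + x₂)
  have b2 := h₂.integral_abs_le hR x₁
  rw [hx₁] at b2
  nlinarith [sq_nonneg s]

end IsSupportDensity

/-- A norming functional `ψ` of `|x|` is automatically positive by smoothness: for `v ≥ 0` adding a
multiple of `v` to `|x|` cannot shorten it, so the modulus bounds the norm after subtraction and
yields `ψ v ≥ -2‖v‖ρ(τ)/τ`, which tends to `0`. -/
theorem exists_isSupportDensity [Lattice X] [IsOrderedAddMonoid X] [HasSolidNorm X]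
    [CompleteSpace X] [UniformConvexSpace X] [IsFiniteMeasure μ] {J : X →L[ℝ] Lp ℝ 1 μ} {u : X}
    [IsOrderedModule ℝ X] (hR : IsFunctionRepresentation J u) (hs : IsUniformlySmooth X) {x : X}
    (hx : ‖x‖ = 1) : ∃ q, IsSupportDensity J x q := by
  have hx' : ‖|x|‖ = 1 := by rwa [norm_abs_eq_norm]
  obtain ⟨ψ, hψ1, hψx⟩ := exists_dual_vector ℝ |x| (fun h => by simp [h] at hx')
  replace hψx : ψ |x| = 1 := by rw [hψx, hx']; rfl
  have hle : ∀ y, ψ y ≤ ‖y‖ := fun y =>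
    (le_abs_self _).trans ((ψ.le_opNorm y).trans_eq (by rw [hψ1, one_mul]))
  have hpos : ∀ v, 0 ≤ v → 0 ≤ ψ v := by
    intro v hv
    rcases eq_or_ne v 0 with rfl | hv0
    · rw [map_zero]
    have hr : 0 < ‖v‖ := norm_pos_iff.2 hv0
    have hlim : Tendsto (fun τ : ℝ => -(2 * ‖v‖ * (smoothnessModulus X τ / τ))) (𝓝[>] 0) (𝓝 0) := by
      simpa using (Tendsto.const_mul (2 * ‖v‖) hs).neg
    refine le_of_tendsto hlim (eventually_nhdsWithin_of_forall fun τ hτ => ?_)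
    have hτ' : 0 < τ := hτ
    have hw0 : 0 ≤ (τ / ‖v‖) • v := smul_nonneg (by positivity) hv
    have hw : ‖(τ / ‖v‖) • v‖ = τ := by
      rw [norm_smul, Real.norm_of_nonneg (by positivity), div_mul_cancel₀ _ hr.ne']
    have h1 := norm_add_add_norm_sub_le hx' hw
    have h2 : 1 ≤ ‖|x| + (τ / ‖v‖) • v‖ := by
      rw [← hx']
      exact norm_le_norm_of_nonneg_of_le (abs_nonneg x) (le_add_of_nonneg_right hw0)
    have h3 := hle (|x| - (τ / ‖v‖) • v)
    rw [map_sub, hψx, map_smul, smul_eq_mul] at h3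
    have h4 : -(2 * smoothnessModulus X τ) ≤ τ / ‖v‖ * ψ v := by linarith
    have h5 : -(2 * ‖v‖ * (smoothnessModulus X τ / τ)) =
        -(2 * smoothnessModulus X τ) * (‖v‖ / τ) := by ring
    rw [h5]
    calc -(2 * smoothnessModulus X τ) * (‖v‖ / τ) ≤ τ / ‖v‖ * ψ v * (‖v‖ / τ) := by gcongr
      _ = ψ v := by field_simp
  obtain ⟨q, hq, hq0, hqψ⟩ := hR.exists_density ψ hpos
  refine ⟨q, hq, hq0, fun y => (hqψ y).1, fun y => (hqψ y).2.trans_le (hle y), ?_⟩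
  rw [← hψx, ← (hqψ |x|).2]
  refine integral_congr_ae ?_
  filter_upwards [hR.ae_abs x] with ω hω
  rw [hω, abs_mul, abs_of_nonneg (hq0 ω)]

end SupportDensity

/-! ### Approximate factorisation by entropy maximisation -/

section Entropy

variable {X : Type*} [NormedAddCommGroup X] [NormedSpace ℝ X]
  {Ω : Type*} [MeasurableSpace Ω] {μ : Measure Ω}

/-- The regularised entropy functional `x ↦ ∫ h log (|x| + ε)`. -/
noncomputable def entropy (J : X →L[ℝ] Lp ℝ 1 μ) (h : Ω → ℝ) (ε : ℝ) (x : X) : ℝ :=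
  ∫ ω, h ω * Real.log (|J x ω| + ε) ∂μ

variable {J : X →L[ℝ] Lp ℝ 1 μ} {u : X} {h : Ω → ℝ} {C ε : ℝ}

theorem abs_log_sub_log_le {a b ε : ℝ} (ha : 0 ≤ a) (hb : 0 ≤ b) (hε : 0 < ε) :
    |Real.log (a + ε) - Real.log (b + ε)| ≤ |a - b| / ε := by
  have key : ∀ a b : ℝ, 0 ≤ a → 0 ≤ b → Real.log (a + ε) - Real.log (b + ε) ≤ |a - b| / ε := by
    intro a b ha hb
    rw [← Real.log_div (by positivity) (by positivity)]
    have h1 := Real.log_le_sub_one_of_pos (show 0 < (a + ε) / (b + ε) by positivity)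
    refine h1.trans ?_
    rw [div_sub_one (by positivity), add_sub_add_right_eq_sub]
    calc (a - b) / (b + ε) ≤ |a - b| / (b + ε) := by gcongr; exact le_abs_self _
      _ ≤ |a - b| / ε := by gcongr; linarith
  rw [abs_le']
  refine ⟨key a b ha hb, ?_⟩
  rw [neg_sub, abs_sub_comm]
  exact key b a hb ha

theorem integrable_entropy [IsFiniteMeasure μ] (hh : Measurable h) (h0 : ∀ ω, 0 ≤ h ω)
    (hC : ∀ ω, h ω ≤ C) (hε : 0 < ε) (x : X) :
    Integrable (fun ω => h ω * Real.log (|J x ω| + ε)) μ := by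
  have hJ : Integrable (J x) μ := L1.integrable_coeFn _
  have hdom : Integrable (fun ω => C * (|J x ω| / ε + |Real.log ε|)) μ :=
    ((hJ.abs.div_const ε).add (integrable_const _)).const_mul C
  have hm : Measurable fun ω => |J x ω| := (Lp.stronglyMeasurable (J x)).measurable.abs
  refine hdom.mono' (hh.mul (hm.add_const ε).log).aestronglyMeasurable
    (Eventually.of_forall fun ω => ?_)
  rw [Real.norm_eq_abs, abs_mul, abs_of_nonneg (h0 ω)]
  refine mul_le_mul (hC ω) ?_ (abs_nonneg _) ((h0 ω).trans (hC ω))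
  have h1 := abs_log_sub_log_le (abs_nonneg (J x ω)) le_rfl hε
  rw [zero_add, sub_zero, abs_abs] at h1
  have h2 := abs_sub_abs_le_abs_sub (Real.log (|J x ω| + ε)) (Real.log ε)
  linarith

theorem abs_entropy_sub_le [IsFiniteMeasure μ] (hh : Measurable h) (h0 : ∀ ω, 0 ≤ h ω)
    (hC : ∀ ω, h ω ≤ C) (hε : 0 < ε) (x y : X) :
    |entropy J h ε y - entropy J h ε x| ≤ C / ε * ‖J (y - x)‖ := by
  rw [entropy, entropy,
    ← integral_sub (integrable_entropy hh h0 hC hε y) (integrable_entropy hh h0 hC hε x),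
    L1.norm_eq_integral_norm, ← integral_const_mul]
  refine (abs_integral_le_integral_abs).trans (integral_mono_ae
    ((integrable_entropy hh h0 hC hε y).sub (integrable_entropy hh h0 hC hε x)).abs
    ((L1.integrable_coeFn (J (y - x))).norm.const_mul _) ?_)
  filter_upwards [IsFunctionRepresentation.ae_sub J y x] with ω hω
  rw [hω, ← mul_sub, abs_mul, abs_of_nonneg (h0 ω), div_mul_eq_mul_div, mul_div_assoc,
    Real.norm_eq_abs]
  refine mul_le_mul (hC ω) ((abs_log_sub_log_le (abs_nonneg _) (abs_nonneg _) hε).trans ?_)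
    (abs_nonneg _) ((h0 ω).trans (hC ω))
  exact div_le_div_of_nonneg_right (abs_abs_sub_abs_le _ _) hε.le

theorem continuous_entropy [IsFiniteMeasure μ] (hh : Measurable h) (h0 : ∀ ω, 0 ≤ h ω)
    (hC : ∀ ω, h ω ≤ C) (hε : 0 < ε) : Continuous (entropy J h ε) := by
  rw [Metric.continuous_iff']
  intro x δ hδ
  have hlim : Tendsto (fun y => C / ε * ‖J (y - x)‖) (𝓝 x) (𝓝 0) := by
    have : Continuous fun y => C / ε * ‖J (y - x)‖ := by fun_prop
    simpa using this.tendsto x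
  filter_upwards [hlim.eventually (gt_mem_nhds hδ)] with y hy
  exact (abs_entropy_sub_le hh h0 hC hε x y).trans_lt hy

variable [Lattice X] [IsOrderedAddMonoid X] [IsOrderedModule ℝ X]

theorem concaveOn_entropy [IsFiniteMeasure μ] (hR : IsFunctionRepresentation J u)
    (hh : Measurable h) (h0 : ∀ ω, 0 ≤ h ω) (hC : ∀ ω, h ω ≤ C) (hε : 0 < ε) :
    ConcaveOn ℝ {x : X | 0 ≤ x ∧ ‖x‖ ≤ 1} (entropy J h ε) := by
  refine ⟨?_, fun x hx y hy a b ha hb hab => ?_⟩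
  · intro x hx y hy a b ha hb hab
    exact ⟨add_nonneg (smul_nonneg ha hx.1) (smul_nonneg hb hy.1), by
      simpa using convex_closedBall (0 : X) 1 (by simpa using hx.2) (by simpa using hy.2) ha hb hab⟩
  · simp only [entropy, smul_eq_mul]
    rw [← integral_const_mul, ← integral_const_mul,
      ← integral_add ((integrable_entropy hh h0 hC hε x).const_mul a)
        ((integrable_entropy hh h0 hC hε y).const_mul b)]
    refine integral_mono_ae (((integrable_entropy hh h0 hC hε x).const_mul a).add
      ((integrable_entropy hh h0 hC hε y).const_mul b)) (integrable_entropy hh h0 hC hε _) ?_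
    filter_upwards [IsFunctionRepresentation.ae_add J (a • x) (b • y),
      IsFunctionRepresentation.ae_smul J a x, IsFunctionRepresentation.ae_smul J b y,
      hR.nonneg_iff.1 hx.1, hR.nonneg_iff.1 hy.1] with ω h1 h2 h3 h4 h5
    rw [h1, h2, h3, abs_of_nonneg h4, abs_of_nonneg h5, abs_of_nonneg (by positivity)]
    have hlog := strictConcaveOn_log_Ioi.concaveOn.2
      (show J x ω + ε ∈ Set.Ioi 0 from Set.mem_Ioi.2 (by positivity))
      (show J y ω + ε ∈ Set.Ioi 0 from Set.mem_Ioi.2 (by positivity)) ha hb hab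
    simp only [smul_eq_mul] at hlog
    have e : a * (J x ω + ε) + b * (J y ω + ε) = a * J x ω + b * J y ω + ε := by
      linear_combination ε * hab
    rw [e] at hlog
    calc a * (h ω * Real.log (J x ω + ε)) + b * (h ω * Real.log (J y ω + ε))
        = h ω * (a * Real.log (J x ω + ε) + b * Real.log (J y ω + ε)) := by ring
      _ ≤ _ := mul_le_mul_of_nonneg_left hlog (h0 ω)

/-- First order condition for a maximiser of the entropy. -/
theorem integral_le_of_forall_entropy_le [IsFiniteMeasure μ] (hR : IsFunctionRepresentation J u)
    (hh : Measurable h) (h0 : ∀ ω, 0 ≤ h ω) (hC : ∀ ω, h ω ≤ C) (hε : 0 < ε) {x : X} (hx : 0 ≤ x)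
    (hx1 : ‖x‖ ≤ 1)
    (hmax : ∀ y, 0 ≤ y → ‖y‖ ≤ 1 → entropy J h ε y ≤ entropy J h ε x) {y : X} (hy : 0 ≤ y)
    (hy1 : ‖y‖ ≤ 1) :
    ∫ ω, h ω / (|J x ω| + ε) * J (y - x) ω ∂μ ≤ 0 := by
  set t : ℕ → ℝ := fun n => 1 / ((n : ℝ) + 1) with ht
  have ht0 : ∀ n, 0 < t n := fun n => by positivity
  have ht1 : ∀ n, t n ≤ 1 := fun n => by
    rw [ht]
    simp only
    rw [div_le_one (by positivity)]
    linarith [(Nat.cast_nonneg n : (0 : ℝ) ≤ n)]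
  have hx' := hR.nonneg_iff.1 hx
  have hy' := hR.nonneg_iff.1 hy
  have hJm : ∀ z : X, Measurable (J z) := fun z => (Lp.stronglyMeasurable (J z)).measurable
  set F : ℕ → Ω → ℝ := fun n ω => h ω / (|J x ω + t n * J (y - x) ω| + ε) * J (y - x) ω with hF
  have hFm : ∀ n, Measurable (F n) := fun n =>
    (hh.div (((hJm x).add ((hJm (y - x)).const_mul _)).abs.add_const ε)).mul (hJm _)
  have hbound : ∀ n ω, ‖F n ω‖ ≤ C / ε * ‖J (y - x) ω‖ := by
    intro n ω
    rw [hF]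
    simp only
    rw [norm_mul, norm_div, Real.norm_of_nonneg (h0 ω), Real.norm_of_nonneg (by positivity)]
    gcongr
    · exact (h0 ω).trans (hC ω)
    · exact hC ω
    · linarith [abs_nonneg (J x ω + t n * J (y - x) ω)]
  have hdom : Integrable (fun ω => C / ε * ‖J (y - x) ω‖) μ :=
    (L1.integrable_coeFn (J (y - x))).norm.const_mul _
  have hFi : ∀ n, Integrable (F n) μ := fun n =>
    hdom.mono' (hFm n).aestronglyMeasurable (Eventually.of_forall (hbound n))
  have hFle : ∀ n, ∫ ω, F n ω ∂μ ≤ 0 := by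
    intro n
    have hz0 : 0 ≤ (1 - t n) • x + t n • y :=
      add_nonneg (smul_nonneg (by linarith [ht1 n]) hx) (smul_nonneg (ht0 n).le hy)
    have hz1 : ‖(1 - t n) • x + t n • y‖ ≤ 1 := by
      simpa using convex_closedBall (0 : X) 1 (by simpa using hx1) (by simpa using hy1)
        (show 0 ≤ 1 - t n by linarith [ht1 n]) (ht0 n).le (by ring)
    have hz : (1 - t n) • x + t n • y = x + t n • (y - x) := by
      rw [sub_smul, one_smul, smul_sub]; abel
    have hm := hmax _ hz0 hz1
    have hzn := hR.nonneg_iff.1 hz0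
    rw [hz] at hm hzn
    have hi1 := integrable_entropy (J := J) hh h0 hC hε (x + t n • (y - x))
    have hi2 := integrable_entropy (J := J) hh h0 hC hε x
    have hle : ∫ ω, t n * F n ω ∂μ ≤ entropy J h ε (x + t n • (y - x)) - entropy J h ε x := by
      rw [entropy, entropy, ← integral_sub hi1 hi2]
      refine integral_mono_ae ((hFi n).const_mul _) (hi1.sub hi2) ?_
      filter_upwards [hx', hzn, IsFunctionRepresentation.ae_add J x (t n • (y - x)),
        IsFunctionRepresentation.ae_smul J (t n) (y - x)] with ω h1 h2 h3 h4
      rw [h3, h4] at h2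
      simp only [hF]
      rw [h3, h4, abs_of_nonneg h2, abs_of_nonneg h1, ← mul_sub,
        ← Real.log_div (by positivity) (by positivity)]
      -- Bounding the logarithm below by `1 - 1/r` puts the perturbed point in the denominator; the
      -- regularisation `ε` then dominates the integrands uniformly in `n`.
      have h5 := Real.one_sub_inv_le_log_of_pos
        (show 0 < (J x ω + t n * J (y - x) ω + ε) / (J x ω + ε) by positivity)
      refine le_trans (le_of_eq ?_) (mul_le_mul_of_nonneg_left h5 (h0 ω))
      have h6 : J x ω + t n * J (y - x) ω + ε ≠ 0 := by positivity
      rw [inv_div]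
      field_simp
      ring
    rw [integral_const_mul] at hle
    have : t n * ∫ ω, F n ω ∂μ ≤ 0 := by linarith
    exact nonpos_of_mul_nonpos_right this (ht0 n)
  refine le_of_tendsto' (tendsto_integral_of_dominated_convergence _
    (fun n => (hFm n).aestronglyMeasurable) hdom
    (fun n => Eventually.of_forall (hbound n)) (Eventually.of_forall fun ω => ?_)) hFle
  have htlim : Tendsto t atTop (𝓝 0) := tendsto_one_div_add_atTop_nhds_zero_nat
  have hden : Tendsto (fun n => |J x ω + t n * J (y - x) ω| + ε) atTop (𝓝 (|J x ω| + ε)) := by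
    have := ((htlim.mul_const (J (y - x) ω)).const_add (J x ω)).abs.add_const ε
    simpa using this
  exact (tendsto_const_nhds.div hden (by positivity)).mul_const _

variable [HasSolidNorm X] [CompleteSpace X] [UniformConvexSpace X]

/-- The entropy attains its maximum on the positive part of the unit ball. -/
theorem exists_forall_entropy_le [IsFiniteMeasure μ] (hR : IsFunctionRepresentation J u)
    (hh : Measurable h) (h0 : ∀ ω, 0 ≤ h ω) (hC0 : 0 ≤ C) (hC : ∀ ω, h ω ≤ C) (hε : 0 < ε) :
    ∃ x : X, 0 ≤ x ∧ ‖x‖ ≤ 1 ∧ ∀ y, 0 ≤ y → ‖y‖ ≤ 1 → entropy J h ε y ≤ entropy J h ε x := by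
  set S : Set X := {x : X | 0 ≤ x ∧ ‖x‖ ≤ 1} with hS
  have hSc : IsClosed S := (isClosed_le continuous_const continuous_id).inter
    (isClosed_le continuous_norm continuous_const)
  have hconc := concaveOn_entropy hR hh h0 hC hε
  have hcont := continuous_entropy (J := J) hh h0 hC hε
  have hS0 : (0 : X) ∈ S := ⟨le_rfl, by simp⟩
  have hbdd : BddAbove (entropy J h ε '' S) := by
    refine ⟨entropy J h ε 0 + C / ε * (‖J‖ * 1), ?_⟩
    rintro _ ⟨x, hx, rfl⟩
    have h1 := (le_abs_self _).trans (abs_entropy_sub_le (J := J) hh h0 hC hε 0 x)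
    rw [sub_zero] at h1
    have h2 : C / ε * ‖J x‖ ≤ C / ε * (‖J‖ * 1) := by
      refine mul_le_mul_of_nonneg_left ?_ (by positivity)
      exact (J.le_opNorm x).trans (mul_le_mul_of_nonneg_left hx.2 (norm_nonneg _))
    linarith
  set M := sSup (entropy J h ε '' S) with hM
  have hle : ∀ y ∈ S, entropy J h ε y ≤ M := fun y hy => le_csSup hbdd ⟨y, hy, rfl⟩
  -- The near-maximal superlevel sets are nested, closed, bounded and, by concavity, convex; a
  -- common point is a maximiser.
  obtain ⟨x, hx⟩ := exists_mem_forall_of_antitone_convex (E := X)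
    (C := fun n : ℕ => {x ∈ S | M - 1 / ((n : ℝ) + 1) ≤ entropy J h ε x}) (R := 1)
    (fun n m hnm x hx => ⟨hx.1, le_trans (by
      have : 1 / ((m : ℝ) + 1) ≤ 1 / ((n : ℝ) + 1) := Nat.one_div_le_one_div hnm
      linarith) hx.2⟩)
    (fun n => hSc.inter (isClosed_le continuous_const hcont))
    (fun n => hconc.convex_ge _)
    (fun n => by
      obtain ⟨_, ⟨y, hy, rfl⟩, hlt⟩ := exists_lt_of_lt_csSup (Set.Nonempty.image _ ⟨0, hS0⟩)
        (show M - 1 / ((n : ℝ) + 1) < sSup (entropy J h ε '' S) by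
          have : 0 < 1 / ((n : ℝ) + 1) := by positivity
          linarith)
      exact ⟨y, hy, hlt.le⟩)
    (fun x hx => hx.1.2)
  refine ⟨x, (hx 0).1.1, (hx 0).1.2, fun y hy0 hy1 => (hle y ⟨hy0, hy1⟩).trans ?_⟩
  have hlim : Tendsto (fun n : ℕ => M - 1 / ((n : ℝ) + 1)) atTop (𝓝 M) := by
    simpa using tendsto_one_div_add_atTop_nhds_zero_nat.const_sub M
  exact le_of_tendsto' hlim fun n => (hx n).2

/-- Every bounded nonnegative function is approximately of the form `q * J x` with `q` a support
density of a positive normalised `x`. -/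
theorem exists_isSupportDensity_approx_of_bounded [IsFiniteMeasure μ]
    (hR : IsFunctionRepresentation J u) (hh : Measurable h) (h0 : ∀ ω, 0 ≤ h ω)
    (hC0 : 0 ≤ C) (hC : ∀ ω, h ω ≤ C) (hm : 0 < ∫ ω, h ω ∂μ) (hε : 0 < ε) :
    ∃ (x : X) (q : Ω → ℝ), 0 ≤ x ∧ ‖x‖ = 1 ∧ IsSupportDensity J x q ∧
      ∫ ω, |q ω * J x ω - h ω| ∂μ ≤ |1 - ∫ ω, h ω ∂μ| + 2 * ε * ∫ ω, h ω ∂μ := by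
  obtain ⟨x, hx0, hx1, hmax⟩ := exists_forall_entropy_le hR hh h0 hC0 hC hε
  set m := ∫ ω, h ω ∂μ with hmdef
  have hJm : ∀ z : X, Measurable (J z) := fun z => (Lp.stronglyMeasurable (J z)).measurable
  have hJi : ∀ z : X, Integrable (J z) μ := fun z => L1.integrable_coeFn _
  -- By the first order condition, integration against `k` is maximal on the positive ball at `x`,
  -- so `k` divided by `θ x` is a support density. Moreover `k · J x = h - εk`, so only `εk` and the
  -- normalisation separate it from `h`.
  set k : Ω → ℝ := fun ω => h ω / (|J x ω| + ε) with hk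
  have hkm : Measurable k := hh.div ((hJm x).abs.add_const ε)
  have hk0 : ∀ ω, 0 ≤ k ω := fun ω => div_nonneg (h0 ω) (by positivity)
  have hkC : ∀ ω, k ω ≤ C / ε := fun ω =>
    div_le_div₀ hC0 (hC ω) hε (by linarith [abs_nonneg (J x ω)])
  have hki : ∀ z : X, Integrable (fun ω => k ω * J z ω) μ := fun z =>
    (hJi z).bdd_mul (c := C / ε) hkm.aestronglyMeasurable
      (Eventually.of_forall fun ω => by rw [Real.norm_of_nonneg (hk0 ω)]; exact hkC ω)
  have hki' : Integrable k μ := (integrable_const (C / ε)).mono' hkm.aestronglyMeasurable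
    (Eventually.of_forall fun ω => by rw [Real.norm_of_nonneg (hk0 ω)]; exact hkC ω)
  have hhi : Integrable h μ := (integrable_const C).mono' hh.aestronglyMeasurable
    (Eventually.of_forall fun ω => by rw [Real.norm_of_nonneg (h0 ω)]; exact hC ω)
  set θ : X → ℝ := fun z => ∫ ω, k ω * J z ω ∂μ with hθ
  have hθsmul : ∀ (c : ℝ) z, θ (c • z) = c * θ z := by
    intro c z
    rw [hθ]
    simp only
    rw [← integral_const_mul]
    refine integral_congr_ae ?_
    filter_upwards [IsFunctionRepresentation.ae_smul J c z] with ω hω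
    rw [hω]
    ring
  have hθle : ∀ y, 0 ≤ y → ‖y‖ ≤ 1 → θ y ≤ θ x := by
    intro y hy hy1
    have h1 := integral_le_of_forall_entropy_le hR hh h0 hC hε hx0 hx1 hmax hy hy1
    have h2 : ∫ ω, h ω / (|J x ω| + ε) * J (y - x) ω ∂μ = θ y - θ x := by
      rw [hθ]
      simp only
      rw [← integral_sub (hki y) (hki x)]
      refine integral_congr_ae ?_
      filter_upwards [IsFunctionRepresentation.ae_sub J y x] with ω hω
      rw [hω, mul_sub]
    linarith
  have hu0 : 0 ≤ u := hR.nonneg_iff.2 (by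
    filter_upwards [hR.map_unit] with ω hω
    rw [hω]
    exact zero_le_one)
  have hθu : θ u = ∫ ω, k ω ∂μ := integral_congr_ae (by
    filter_upwards [hR.map_unit] with ω hω
    rw [hω, mul_one])
  -- The unit `u` has norm one and represents the constant `1`, so testing on it gives `∫ k ≤ θ x ≤
  -- m` and makes the error `εk` small in `L¹`.
  have hux := hθle u hu0 hR.norm_unit.le
  have hθu0 : 0 ≤ θ u := by
    rw [hθu]
    exact integral_nonneg hk0
  have hx' := hR.nonneg_iff.1 hx0
  have hkx : ∀ᵐ ω ∂μ, k ω * J x ω = h ω - ε * k ω := by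
    filter_upwards [hx'] with ω hω
    simp only [hk]
    rw [abs_of_nonneg hω]
    have : J x ω + ε ≠ 0 := by positivity
    field_simp
    ring
  have hθx : θ x = m - ε * θ u := by
    rw [hθu, hmdef, ← integral_const_mul, ← integral_sub hhi (hki'.const_mul ε)]
    exact integral_congr_ae hkx
  have hθpos : 0 < θ x := by nlinarith
  have hxne : 0 < ‖x‖ := by
    rw [norm_pos_iff]
    rintro rfl
    have h1 := hθsmul 0 0
    rw [smul_zero, zero_mul] at h1
    exact hθpos.ne' h1
  have hnorm : ‖x‖ = 1 := by
    refine le_antisymm hx1 ?_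
    have h1 := hθle (‖x‖⁻¹ • x) (smul_nonneg (inv_nonneg.2 hxne.le) hx0)
      (by rw [norm_smul, norm_inv, norm_norm, inv_mul_cancel₀ hxne.ne'])
    rw [hθsmul, inv_mul_le_iff₀ hxne] at h1
    exact (le_mul_iff_one_le_left hθpos).1 h1
  have hθnorm : ∀ y, θ y ≤ ‖y‖ * θ x := by
    intro y
    have h1 : θ y ≤ θ |y| := by
      refine integral_mono_ae (hki y) (hki _) ?_
      filter_upwards [hR.ae_abs y] with ω hω
      rw [hω]
      exact mul_le_mul_of_nonneg_left (le_abs_self _) (hk0 ω)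
    refine h1.trans ?_
    rcases eq_or_ne y 0 with rfl | hy
    · have h2 := hθsmul 0 |0|
      rw [zero_smul, zero_mul] at h2
      simp [h2]
    · have hy' : 0 < ‖y‖ := norm_pos_iff.2 hy
      have h2 := hθle (‖y‖⁻¹ • |y|) (smul_nonneg (inv_nonneg.2 hy'.le) (abs_nonneg y))
        (by rw [norm_smul, norm_inv, norm_norm, norm_abs_eq_norm, inv_mul_cancel₀ hy'.ne'])
      rwa [hθsmul, inv_mul_le_iff₀ hy'] at h2
  have hqJ : ∀ z ω, (θ x)⁻¹ * k ω * J z ω = (θ x)⁻¹ * (k ω * J z ω) := fun z ω => mul_assoc _ _ _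
  refine ⟨x, fun ω => (θ x)⁻¹ * k ω, hx0, hnorm, ⟨hkm.const_mul _, fun ω =>
    mul_nonneg (inv_nonneg.2 hθpos.le) (hk0 ω), fun z => ?_, fun z => ?_, ?_⟩, ?_⟩
  · simp only [hqJ]
    exact (hki z).const_mul _
  · simp only [hqJ]
    rw [integral_const_mul, inv_mul_le_iff₀ hθpos, mul_comm]
    exact hθnorm z
  · have : ∀ᵐ ω ∂μ, |(θ x)⁻¹ * k ω * J x ω| = (θ x)⁻¹ * (k ω * J x ω) := by
      filter_upwards [hx'] with ω hω
      rw [hqJ, abs_of_nonneg (mul_nonneg (inv_nonneg.2 hθpos.le) (mul_nonneg (hk0 ω) hω))]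
    rw [integral_congr_ae this, integral_const_mul]
    exact inv_mul_cancel₀ hθpos.ne'
  · have hi1 : Integrable (fun ω => |(θ x)⁻¹ - 1| * (k ω * J x ω)) μ := (hki x).const_mul _
    have hi2 : Integrable (fun ω => ε * k ω) μ := hki'.const_mul ε
    have hle : ∫ ω, |(θ x)⁻¹ * k ω * J x ω - h ω| ∂μ ≤ |(θ x)⁻¹ - 1| * θ x + ε * θ u := by
      rw [hθu, ← integral_const_mul, ← integral_const_mul, ← integral_add hi1 hi2]
      refine integral_mono_ae ((((hki x).const_mul (θ x)⁻¹).congr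
        (Eventually.of_forall fun ω => (hqJ x ω).symm)).sub hhi).abs (hi1.add hi2) ?_
      filter_upwards [hx', hkx] with ω h1 h2
      have e : (θ x)⁻¹ * k ω * J x ω - h ω =
          ((θ x)⁻¹ - 1) * (k ω * J x ω) + -(ε * k ω) := by
        linear_combination h2
      rw [e]
      refine (abs_add_le _ _).trans_eq ?_
      rw [abs_neg, abs_mul, abs_of_nonneg (mul_nonneg (hk0 ω) h1),
        abs_of_nonneg (mul_nonneg hε.le (hk0 ω))]
    have h3 : |(θ x)⁻¹ - 1| * θ x = |1 - θ x| := by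
      rw [← abs_of_pos hθpos, ← abs_mul, abs_of_pos hθpos, sub_mul, inv_mul_cancel₀ hθpos.ne',
        one_mul]
    have h4 : |1 - θ x| ≤ |1 - m| + ε * θ u := by
      have h5 : 1 - θ x = (1 - m) + ε * θ u := by rw [hθx]; ring
      rw [h5]
      exact (abs_add_le _ _).trans_eq (by rw [abs_of_nonneg (mul_nonneg hε.le hθu0)])
    have h6 : ε * θ u ≤ ε * m := by
      refine mul_le_mul_of_nonneg_left (hux.trans ?_) hε.le
      rw [hθx]
      linarith [mul_nonneg hε.le hθu0]
    linarith

/-- Truncate `f²` to a bounded function, factor that approximately, and transfer the sign of `f` to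
the lattice element while keeping the density. -/
theorem exists_isSupportDensity_approx [IsFiniteMeasure μ] (hR : IsFunctionRepresentation J u)
    {f : Ω → ℝ} (hf : Measurable f) (hfi : Integrable (fun ω => f ω ^ 2) μ)
    (hf1 : ∫ ω, f ω ^ 2 ∂μ = 1) {η : ℝ} (hη : 0 < η) :
    ∃ (z : X) (q : Ω → ℝ), ‖z‖ = 1 ∧ IsSupportDensity J z q ∧
      ∫ ω, |q ω * J z ω - f ω * abs (f ω)| ∂μ < η := by
  set g : ℕ → Ω → ℝ := fun n ω => min (f ω ^ 2) n with hg
  have hgm : ∀ n, Measurable (g n) := fun n => (hf.pow_const 2).min measurable_const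
  have hg0 : ∀ n ω, 0 ≤ g n ω := fun n ω => le_min (sq_nonneg _) (Nat.cast_nonneg n)
  have hgf : ∀ n ω, g n ω ≤ f ω ^ 2 := fun n ω => min_le_left _ _
  have hgi : ∀ n, Integrable (g n) μ := fun n => hfi.mono' (hgm n).aestronglyMeasurable
    (Eventually.of_forall fun ω => by rw [Real.norm_of_nonneg (hg0 n ω)]; exact hgf n ω)
  have hglim : Tendsto (fun n => ∫ ω, g n ω ∂μ) atTop (𝓝 1) := by
    rw [← hf1]
    refine tendsto_integral_of_dominated_convergence _
      (fun n => (hgm n).aestronglyMeasurable) hfi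
      (fun n => Eventually.of_forall fun ω => by
        rw [Real.norm_of_nonneg (hg0 n ω)]; exact hgf n ω) (Eventually.of_forall fun ω => ?_)
    obtain ⟨N, hN⟩ := exists_nat_ge (f ω ^ 2)
    refine tendsto_const_nhds.congr' ?_
    filter_upwards [eventually_ge_atTop N] with n hn
    exact (min_eq_left (hN.trans (Nat.cast_le.2 hn))).symm
  -- The bound `1/2` keeps the truncated mass positive; `η/4` pays for the missing mass, which
  -- enters the error twice.
  obtain ⟨n, hn⟩ := (hglim.eventually (lt_mem_nhds (show 1 - min (η / 4) (1 / 2) < 1 by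
    have : 0 < min (η / 4) (1 / 2) := by positivity
    linarith))).exists
  set m := ∫ ω, g n ω ∂μ with hm
  have hm1 : m ≤ 1 := by
    rw [← hf1]
    exact integral_mono (hgi n) hfi (hgf n)
  have hm2 : 1 - m < η / 4 := by linarith [min_le_left (η / 4) (1 / 2)]
  have hm3 : 0 < m := by linarith [min_le_right (η / 4) (1 / 2)]
  obtain ⟨x, q, hx0, hx1, hq, hle⟩ := exists_isSupportDensity_approx_of_bounded hR (hgm n) (hg0 n)
    (Nat.cast_nonneg n) (fun ω => min_le_right _ _) hm3 (show 0 < η / 8 by positivity)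
  rw [← hm, abs_of_nonneg (by linarith : 0 ≤ 1 - m)] at hle
  have hσ : Measurable fun ω => if 0 ≤ f ω then (1 : ℝ) else -1 :=
    Measurable.ite (measurableSet_le measurable_const hf) measurable_const measurable_const
  have habs : ∀ ω, |if 0 ≤ f ω then (1 : ℝ) else -1| = 1 := fun ω => by split_ifs <;> simp
  have hx' := hR.nonneg_iff.1 hx0
  obtain ⟨z, hz⟩ := hR.exists_ae_eq
    (f := fun ω => (if 0 ≤ f ω then (1 : ℝ) else -1) * J x ω) (x := x)
    (hσ.aestronglyMeasurable.mul (L1.integrable_coeFn (J x)).1) (by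
      filter_upwards [hx'] with ω h1
      rw [abs_mul, habs, one_mul, abs_of_nonneg h1])
  have hzx : ∀ᵐ ω ∂μ, |J z ω| = |J x ω| := by
    filter_upwards [hz] with ω h1
    rw [h1, abs_mul, habs, one_mul]
  refine ⟨z, q, ?_, ⟨hq.measurable, hq.nonneg, hq.integrable, hq.integral_le, ?_⟩, ?_⟩
  · rw [← hx1]
    exact le_antisymm (hR.norm_le_norm (hzx.mono fun ω h1 => h1.le))
      (hR.norm_le_norm (hzx.mono fun ω h1 => h1.ge))
  · rw [← hq.integral_abs]
    refine integral_congr_ae ?_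
    filter_upwards [hzx] with ω h1
    rw [abs_mul, abs_mul, h1]
  · have hqx : Integrable (fun ω => |q ω * J x ω - g n ω|) μ :=
      ((hq.integrable x).sub (hgi n)).abs
    have hfg : Integrable (fun ω => f ω ^ 2 - g n ω) μ := hfi.sub (hgi n)
    have hpt : ∀ᵐ ω ∂μ, |q ω * J z ω - f ω * abs (f ω)| = |q ω * J x ω - f ω ^ 2| := by
      filter_upwards [hz] with ω h1
      have e : q ω * J z ω - f ω * |f ω| =
          (if 0 ≤ f ω then (1 : ℝ) else -1) * (q ω * J x ω - f ω ^ 2) := by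
        rw [h1]
        split_ifs with h2
        · rw [abs_of_nonneg h2]
          ring
        · rw [abs_of_neg (not_le.1 h2)]
          ring
      rw [e, abs_mul, habs, one_mul]
    rw [integral_congr_ae hpt]
    have h5 : ∫ ω, |q ω * J x ω - f ω ^ 2| ∂μ ≤
        ∫ ω, |q ω * J x ω - g n ω| ∂μ + (1 - m) := by
      rw [← hf1, hm, ← integral_sub hfi (hgi n), ← integral_add hqx hfg]
      refine integral_mono ((hq.integrable x).sub hfi).abs (hqx.add hfg) fun ω => ?_
      have h6 := abs_add_le (q ω * J x ω - g n ω) (-(f ω ^ 2 - g n ω))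
      rw [abs_neg, abs_of_nonneg (sub_nonneg.2 (hgf n ω))] at h6
      refine le_trans (le_of_eq ?_) h6
      congr 1
      ring
    nlinarith

end Entropy

/-! ### Identification of the target with `ℓ²` -/

section HilbertBasis

variable {H : Type*} [NormedAddCommGroup H] [InnerProductSpace ℝ H]

theorem Orthonormal.countable_of_separableSpace [TopologicalSpace.SeparableSpace H] {ι : Type*}
    {v : ι → H} (hv : Orthonormal ℝ v) : Countable ι := by
  have hdisj : (Set.univ : Set ι).PairwiseDisjoint fun i => Metric.ball (v i) (1 / 2) := by
    intro i _ j _ hij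
    refine Metric.ball_disjoint_ball ?_
    rw [dist_eq_norm]
    have h1 : ‖v i - v j‖ ^ 2 = 2 := by
      rw [norm_sub_sq_real, hv.1 i, hv.1 j, hv.2 hij]
      norm_num
    nlinarith [norm_nonneg (v i - v j)]
  have := hdisj.countable_of_isOpen (fun _ _ => Metric.isOpen_ball) fun i _ =>
    ⟨v i, Metric.mem_ball_self (by norm_num)⟩
  exact Set.countable_univ_iff.1 this

theorem nonempty_linearIsometryEquiv_l2 [CompleteSpace H] [TopologicalSpace.SeparableSpace H]
    (hH : ¬ FiniteDimensional ℝ H) : Nonempty (H ≃ₗᵢ[ℝ] lp (fun _ : ℕ => ℝ) 2) := by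
  obtain ⟨w, b, hb⟩ := exists_hilbertBasis ℝ H
  have hc : Countable w := b.orthonormal.countable_of_separableSpace
  have hi : Infinite w := by
    rw [← not_finite_iff_infinite]
    intro hfin
    have := Fintype.ofFinite w
    exact hH (Module.Finite.of_basis b.toOrthonormalBasis.toBasis)
  obtain ⟨e⟩ : Nonempty (ℕ ≃ w) := by
    obtain ⟨hd⟩ := nonempty_denumerable w
    exact ⟨(Denumerable.eqv w).symm⟩
  have hr : Set.range (b ∘ e) = Set.range b := e.surjective.range_comp b
  exact ⟨(HilbertBasis.mk (b.orthonormal.comp e e.injective)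
    (by rw [hr, b.dense_span])).repr⟩

end HilbertBasis

section SphereTransfer

variable {E : Type*} [NormedAddCommGroup E] [NormedSpace ℝ E] [Nontrivial E]

/-- Scalar multiplication transports separability, and compactness after restricting scalars to
`[-1, 1]`, from the sphere to the space and its unit ball. -/
theorem surjective_smul_sphere :
    Function.Surjective fun p : ℝ × Metric.sphere (0 : E) 1 => p.1 • (p.2 : E) := by
  intro x
  rcases eq_or_ne x 0 with rfl | hx
  · obtain ⟨y, hy⟩ := (NormedSpace.sphere_nonempty (x := (0 : E)) (r := 1)).2 zero_le_one
    exact ⟨(0, ⟨y, hy⟩), zero_smul _ _⟩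
  · have hx' : ‖x‖ ≠ 0 := norm_ne_zero_iff.2 hx
    exact ⟨(‖x‖, ⟨‖x‖⁻¹ • x, by simp [norm_smul, hx']⟩), smul_inv_smul₀ hx' x⟩

theorem separableSpace_of_sphere [TopologicalSpace.SeparableSpace (Metric.sphere (0 : E) 1)] :
    TopologicalSpace.SeparableSpace E :=
  (surjective_smul_sphere (E := E)).denseRange.separableSpace (by fun_prop)

theorem finiteDimensional_of_compactSpace_sphere [CompactSpace (Metric.sphere (0 : E) 1)] :
    FiniteDimensional ℝ E := by
  refine FiniteDimensional.of_isCompact_closedBall₀ ℝ one_pos ?_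
  have hc : IsCompact ((fun p : ℝ × Metric.sphere (0 : E) 1 => p.1 • (p.2 : E)) ''
      (Set.Icc (-1) 1 ×ˢ Set.univ)) :=
    (isCompact_Icc.prod isCompact_univ).image (by fun_prop)
  convert! hc using 1
  ext x
  constructor
  · intro hx
    obtain ⟨⟨t, y⟩, rfl⟩ := surjective_smul_sphere x
    refine ⟨(t, y), ⟨?_, trivial⟩, rfl⟩
    simpa [norm_smul, abs_le] using hx
  · rintro ⟨⟨t, y⟩, ⟨ht, -⟩, rfl⟩
    simpa [norm_smul, abs_le] using ht

/-- A Hilbert space whose unit sphere is homeomorphic to that of a separable infinite-dimensional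
normed space is isometric to `ℓ²`. -/
theorem nonempty_linearIsometryEquiv_l2_of_homeomorph_sphere
    [TopologicalSpace.SeparableSpace E] (hE : ¬ FiniteDimensional ℝ E) {H : Type*}
    [NormedAddCommGroup H] [InnerProductSpace ℝ H] [CompleteSpace H]
    (e : Metric.sphere (0 : E) 1 ≃ₜ Metric.sphere (0 : H) 1) :
    Nonempty (H ≃ₗᵢ[ℝ] lp (fun _ : ℕ => ℝ) 2) := by
  obtain ⟨x, hx⟩ := (NormedSpace.sphere_nonempty (x := (0 : E)) (r := 1)).2 zero_le_one
  have hHn : Nontrivial H := by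
    refine ⟨⟨e ⟨x, hx⟩, 0, fun h => ?_⟩⟩
    have := (e ⟨x, hx⟩).2
    rw [h] at this
    simp at this
  have : SecondCountableTopology E := UniformSpace.secondCountable_of_separable E
  have : TopologicalSpace.SeparableSpace (Metric.sphere (0 : H) 1) :=
    e.surjective.denseRange.separableSpace e.continuous
  have : TopologicalSpace.SeparableSpace H := separableSpace_of_sphere
  refine nonempty_linearIsometryEquiv_l2 fun hfin => hE ?_
  have : ProperSpace H := FiniteDimensional.proper ℝ H
  have : CompactSpace (Metric.sphere (0 : E) 1) := e.symm.compactSpace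
  exact finiteDimensional_of_compactSpace_sphere

/-- A linear isometry equivalence restricts to the unit spheres. -/
def LinearIsometryEquiv.sphereEquiv {H K : Type*} [NormedAddCommGroup H] [NormedSpace ℝ H]
    [NormedAddCommGroup K] [NormedSpace ℝ K] (T : H ≃ₗᵢ[ℝ] K) :
    Metric.sphere (0 : H) 1 ≃ Metric.sphere (0 : K) 1 where
  toFun x := ⟨T x, by simp⟩
  invFun y := ⟨T.symm y, by simp⟩
  left_inv x := by simp
  right_inv y := by simp

end SphereTransfer

/-! ### The moduli and the homeomorphism of spheres -/

section Moduli

variable {X : Type*} [NormedAddCommGroup X]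

/-- Fix `τ` with `ρ(τ)/τ < η/8`, then make `d` small compared with `τ`; each of the two
contributions is below `η/2`. -/
theorem IsUniformlySmooth.exists_forall_lt (hs : IsUniformlySmooth X) {η : ℝ} (hη : 0 < η) :
    ∃ d₀ > 0, ∀ d, d < d₀ → ∃ τ > 0, 2 * (d + (2 * smoothnessModulus X τ + d) / τ) < η := by
  obtain ⟨τ, hτ, hτ0⟩ := ((hs.eventually (gt_mem_nhds (show 0 < η / 8 by positivity))).and
    self_mem_nhdsWithin).exists
  have hτ0' : 0 < τ := hτ0
  refine ⟨η / (4 * (1 + 1 / τ)), by positivity, fun d hd => ⟨τ, hτ0', ?_⟩⟩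
  rw [lt_div_iff₀ (by positivity)] at hd
  have e : 2 * (d + (2 * smoothnessModulus X τ + d) / τ) =
      2 * (d * (1 + 1 / τ)) + 4 * (smoothnessModulus X τ / τ) := by ring
  rw [e]
  linarith

variable [NormedSpace ℝ X]

theorem le_convexityModulus {ε δ : ℝ} (hne : Nontrivial X) (hε : ε ≤ 2)
    (h : ∀ x y : X, ‖x‖ = 1 → ‖y‖ = 1 → ε ≤ ‖x - y‖ → δ ≤ 1 - ‖(1 / 2 : ℝ) • (x + y)‖) :
    δ ≤ convexityModulus X ε := by
  obtain ⟨x, hx⟩ := (NormedSpace.sphere_nonempty (x := (0 : X)) (r := 1)).2 zero_le_one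
  rw [mem_sphere_zero_iff_norm] at hx
  -- An antipodal pair shows that the set is nonempty when `ε ≤ 2`, so the infimum is not the
  -- default value.
  refine le_csInf ⟨_, x, -x, hx, by rwa [norm_neg], ?_, rfl⟩ ?_
  · rw [sub_neg_eq_add, ← two_smul ℝ x, norm_smul, hx]
    simpa using hε
  · rintro _ ⟨x, y, hx, hy, hxy, rfl⟩
    exact h x y hx hy hxy

theorem convexityModulus_le {x y : X} (hx : ‖x‖ = 1) (hy : ‖y‖ = 1) {ε : ℝ} (h : ε ≤ ‖x - y‖) :
    convexityModulus X ε ≤ 1 - ‖(1 / 2 : ℝ) • (x + y)‖ := by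
  refine csInf_le ⟨0, ?_⟩ ⟨x, y, hx, hy, h, rfl⟩
  rintro _ ⟨x, y, hx, hy, -, rfl⟩
  have := norm_add_le x y
  rw [norm_smul, Real.norm_of_nonneg (by norm_num)]
  linarith

theorem exists_pos_forall_le_convexityModulus [UniformConvexSpace X] (hne : Nontrivial X) {ε : ℝ}
    (hε : 0 < ε) : ∃ δ > 0, ∀ e, ε ≤ e → e ≤ 2 → δ ≤ convexityModulus X e := by
  obtain ⟨δ, hδ, H⟩ := exists_forall_sphere_dist_add_le_two_sub X hε
  refine ⟨δ / 2, half_pos hδ, fun e he he2 => le_convexityModulus hne he2 fun x y hx hy hxy => ?_⟩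
  have := H hx hy (he.trans hxy)
  rw [norm_smul, Real.norm_of_nonneg (by norm_num)]
  linarith

end Moduli

section SphereMap

open IsSupportDensity

variable {X : Type*} [NormedAddCommGroup X] [NormedSpace ℝ X]
  {Ω : Type*} [MeasurableSpace Ω] {μ : Measure Ω}

theorem inner_toLp_eq {f g : Ω → ℝ} (hf : MemLp f 2 μ) (hg : MemLp g 2 μ) :
    inner ℝ (hf.toLp f) (hg.toLp g) = ∫ ω, f ω * g ω ∂μ := by
  rw [L2.inner_def]
  refine integral_congr_ae ?_
  filter_upwards [hf.coeFn_toLp, hg.coeFn_toLp] with ω h1 h2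
  rw [h1, h2, real_inner_comm]
  simp

theorem norm_toLp_sq_eq {f : Ω → ℝ} (hf : MemLp f 2 μ) :
    ‖hf.toLp f‖ ^ 2 = ∫ ω, f ω ^ 2 ∂μ := by
  rw [← real_inner_self_eq_norm_sq, inner_toLp_eq]
  simp only [sq]

variable {J : X →L[ℝ] Lp ℝ 1 μ} {u x x₁ x₂ : X} {q q₁ q₂ : Ω → ℝ}

/-- The square root of the measure `q * |x|`, with the sign of `x`, as an element of `L²`. -/
noncomputable def IsSupportDensity.halfDensity (h : IsSupportDensity J x q) : Lp ℝ 2 μ :=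
  h.memLp.toLp _

theorem IsSupportDensity.norm_halfDensity (h : IsSupportDensity J x q) : ‖h.halfDensity‖ = 1 := by
  have h1 := norm_toLp_sq_eq h.memLp
  simp only [sq_signedSqrt, h.integral_abs] at h1
  exact (pow_eq_one_iff_of_nonneg (norm_nonneg _) two_ne_zero).1 h1

theorem IsSupportDensity.norm_halfDensity_sub_toLp_le (h : IsSupportDensity J x q) {k : Ω → ℝ}
    (hk : Integrable k μ) (hk' : MemLp (fun ω => signedSqrt (k ω)) 2 μ) :
    ‖h.halfDensity - hk'.toLp _‖ ^ 2 ≤ 2 * ∫ ω, |q ω * J x ω - k ω| ∂μ := by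
  rw [halfDensity, ← MemLp.toLp_sub, norm_toLp_sq_eq, ← integral_const_mul]
  refine integral_mono ((h.memLp.sub hk').integrable_sq)
    (((h.integrable x).sub hk).abs.const_mul 2) fun ω => sq_signedSqrt_sub_le _ _

variable [Lattice X] [IsOrderedAddMonoid X] [HasSolidNorm X]

theorem IsSupportDensity.norm_halfDensity_sub_le (hR : IsFunctionRepresentation J u)
    (h₁ : IsSupportDensity J x₁ q₁) (h₂ : IsSupportDensity J x₂ q₂) (hx₁ : ‖x₁‖ = 1)
    (hx₂ : ‖x₂‖ = 1) {τ : ℝ} (hτ : 0 < τ) :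
    ‖h₁.halfDensity - h₂.halfDensity‖ ^ 2 ≤
      2 * (‖x₁ - x₂‖ + (2 * smoothnessModulus X τ + ‖x₁ - x₂‖) / τ) := by
  refine (h₁.norm_halfDensity_sub_toLp_le (h₂.integrable x₂) h₂.memLp).trans ?_
  exact mul_le_mul_of_nonneg_left (integral_abs_sub_le hR h₁ h₂ hx₁ hx₂ hτ) zero_le_two

/-- The continuity estimate at distance zero shows that the choice of support density is immaterial;
the density argument relies on this. -/
theorem IsSupportDensity.halfDensity_eq (hR : IsFunctionRepresentation J u)
    (hs : IsUniformlySmooth X) (h₁ : IsSupportDensity J x q₁) (h₂ : IsSupportDensity J x q₂)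
    (hx : ‖x‖ = 1) : h₁.halfDensity = h₂.halfDensity := by
  rw [← sub_eq_zero, ← norm_eq_zero, ← sq_eq_zero_iff]
  refine le_antisymm (le_of_forall_pos_le_add fun η hη => ?_) (sq_nonneg _)
  obtain ⟨d₀, hd₀, H⟩ := hs.exists_forall_lt hη
  obtain ⟨τ, hτ, hlt⟩ := H 0 hd₀
  have := norm_halfDensity_sub_le hR h₁ h₂ hx hx hτ
  rw [sub_self, norm_zero] at this
  linarith

/-- For unit vectors with inner product `s` the squared distance is `2 - 2s`, which is at least `1 -
s²`; for `s ≤ 0` it is at least `1`. -/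
theorem IsSupportDensity.one_sub_norm_le (hR : IsFunctionRepresentation J u)
    (h₁ : IsSupportDensity J x₁ q₁) (h₂ : IsSupportDensity J x₂ q₂) (hx₁ : ‖x₁‖ = 1) :
    1 - ‖(1 / 2 : ℝ) • (x₁ + x₂)‖ ≤ ‖h₁.halfDensity - h₂.halfDensity‖ ^ 2 := by
  rw [norm_sub_sq_real, h₁.norm_halfDensity, h₂.norm_halfDensity, norm_smul,
    Real.norm_of_nonneg (by norm_num)]
  set s := inner ℝ h₁.halfDensity h₂.halfDensity with hs
  rcases le_total 0 s with h | h
  · have := two_mul_sq_le_norm_add hR h₁ h₂ hx₁ h (inner_toLp_eq h₁.memLp h₂.memLp)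
    nlinarith [sq_nonneg (s - 1)]
  · have := norm_nonneg (x₁ + x₂)
    linarith

/-- Smoothness makes `G` uniformly continuous and convexity does the same for its inverse on the
range. The sphere of `X` is complete, so the range is closed, and the entropy approximation makes it
dense. -/
theorem exists_sphere_equiv_L2 [CompleteSpace X] [UniformConvexSpace X] [IsOrderedModule ℝ X]
    [IsFiniteMeasure μ] (hR : IsFunctionRepresentation J u) (hs : IsUniformlySmooth X) :
    ∃ G : Metric.sphere (0 : X) 1 ≃ₜ Metric.sphere (0 : Lp ℝ 2 μ) 1,
      (∀ x y, ∀ τ > 0, dist (G x) (G y) ^ 2 ≤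
        2 * (dist x y + (2 * smoothnessModulus X τ + dist x y) / τ)) ∧
      ∀ x y : Metric.sphere (0 : X) 1,
        1 - ‖(1 / 2 : ℝ) • ((x : X) + y)‖ ≤ dist (G x) (G y) ^ 2 := by
  have hnorm : ∀ x : Metric.sphere (0 : X) 1, ‖(x : X)‖ = 1 := fun x => norm_eq_of_mem_sphere x
  choose q hq using fun x : Metric.sphere (0 : X) 1 => exists_isSupportDensity hR hs (hnorm x)
  set G : Metric.sphere (0 : X) 1 → Metric.sphere (0 : Lp ℝ 2 μ) 1 := fun x =>
    ⟨(hq x).halfDensity, by simp [(hq x).norm_halfDensity]⟩ with hG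
  have hdist : ∀ x y, dist (G x) (G y) = ‖(hq x).halfDensity - (hq y).halfDensity‖ := fun x y => by
    rw [Subtype.dist_eq, dist_eq_norm]
  have hG1 : ∀ x y, ∀ τ > 0, dist (G x) (G y) ^ 2 ≤
      2 * (dist x y + (2 * smoothnessModulus X τ + dist x y) / τ) := fun x y τ hτ => by
    rw [hdist, Subtype.dist_eq, dist_eq_norm]
    exact norm_halfDensity_sub_le hR (hq x) (hq y) (hnorm x) (hnorm y) hτ
  have hG2 : ∀ x y : Metric.sphere (0 : X) 1,
      1 - ‖(1 / 2 : ℝ) • ((x : X) + y)‖ ≤ dist (G x) (G y) ^ 2 := fun x y => by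
    rw [hdist]
    exact one_sub_norm_le hR (hq x) (hq y) (hnorm x)
  have hind : IsUniformInducing G := by
    rw [Metric.isUniformInducing_iff]
    refine ⟨Metric.uniformContinuous_iff.2 fun ε hε => ?_, fun ε hε => ?_⟩
    · obtain ⟨d₀, hd₀, H⟩ := hs.exists_forall_lt (pow_pos hε 2)
      refine ⟨d₀, hd₀, fun {x y} hxy => ?_⟩
      obtain ⟨τ, hτ, hlt⟩ := H _ hxy
      exact lt_of_pow_lt_pow_left₀ 2 hε.le ((hG1 x y τ hτ).trans_lt hlt)
    · obtain ⟨δ, hδ, H⟩ := exists_forall_sphere_dist_add_le_two_sub X hε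
      refine ⟨√(δ / 2), by positivity, fun {x y} hxy => ?_⟩
      by_contra! hcon
      rw [Subtype.dist_eq, dist_eq_norm] at hcon
      have h1 := H (hnorm x) (hnorm y) hcon
      have h2 := hG2 x y
      rw [norm_smul, Real.norm_of_nonneg (by norm_num)] at h2
      have h3 := (Real.lt_sqrt dist_nonneg).1 hxy
      linarith
  have hdense : DenseRange G := by
    intro g
    rw [Metric.mem_closure_range_iff]
    intro ε hε
    have hgm : StronglyMeasurable (g : Lp ℝ 2 μ) := Lp.stronglyMeasurable _
    have hgL : MemLp (g : Lp ℝ 2 μ) 2 μ := Lp.memLp _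
    have hg1 : ∫ ω, (g : Lp ℝ 2 μ) ω ^ 2 ∂μ = 1 := by
      rw [← norm_toLp_sq_eq hgL, Lp.toLp_coeFn, norm_eq_of_mem_sphere, one_pow]
    obtain ⟨z, p, hz, hp, hlt⟩ := exists_isSupportDensity_approx hR hgm.measurable
      hgL.integrable_sq hg1 (show 0 < ε ^ 2 / 2 by positivity)
    refine ⟨⟨z, by simpa using hz⟩, ?_⟩
    set z' : Metric.sphere (0 : X) 1 := ⟨z, by simpa using hz⟩ with hz'
    have h1 : (hq z').halfDensity = hp.halfDensity := halfDensity_eq hR hs (hq z') hp hz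
    have hsq : (fun ω => signedSqrt ((g : Lp ℝ 2 μ) ω * abs ((g : Lp ℝ 2 μ) ω))) =
        fun ω => (g : Lp ℝ 2 μ) ω := funext fun ω => signedSqrt_mul_abs _
    have hmem : MemLp (fun ω => signedSqrt ((g : Lp ℝ 2 μ) ω * abs ((g : Lp ℝ 2 μ) ω))) 2 μ := by
      rw [hsq]
      exact hgL
    have hint : Integrable (fun ω => (g : Lp ℝ 2 μ) ω * abs ((g : Lp ℝ 2 μ) ω)) μ :=
      hgL.integrable_mul hgL.abs
    have h2 := hp.norm_halfDensity_sub_toLp_le hint hmem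
    have h3 : hmem.toLp _ = (g : Lp ℝ 2 μ) := by
      refine Lp.ext ?_
      filter_upwards [hmem.coeFn_toLp] with ω hω
      rw [hω, signedSqrt_mul_abs]
    rw [h3, ← h1] at h2
    rw [dist_comm, Subtype.dist_eq, dist_eq_norm]
    refine lt_of_pow_lt_pow_left₀ 2 hε.le (h2.trans_lt ?_)
    linarith
  have hcs : CompleteSpace (Metric.sphere (0 : X) 1) := Metric.isClosed_sphere.completeSpace_coe
  have hcomplete : IsComplete (Set.range G) := (completeSpace_iff_isComplete_range hind).1 hcs
  have hsurj : Function.Surjective G := by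
    rw [← Set.range_eq_univ, ← hcomplete.isClosed.closure_eq]
    exact hdense.closure_range
  have hemb : IsEmbedding G := ⟨hind.isInducing, hind.injective⟩
  exact ⟨hemb.toHomeomorphOfSurjective hsurj, hG1, hG2⟩

end SphereMap

/-! ### Continuous moduli from quantitative relations -/

section Majorant

/-- An infimum of affine functions with nonnegative coefficients, positive slopes and arbitrarily
small values at `0` is continuous on `[0, ∞)` and vanishes at `0`. -/
theorem continuous_iInf_affine {η c : ℕ → ℝ} (hη : ∀ n, 0 ≤ η n) (hc : ∀ n, 0 < c n)
    (hlim : Tendsto η atTop (𝓝 0)) :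
    (Continuous fun d : ℝ≥0 => ⨅ n, (η n + c n * (d : ℝ))) ∧ ⨅ n, (η n + c n * (0 : ℝ)) = 0 := by
  set g : ℝ≥0 → ℝ := fun d => ⨅ n, (η n + c n * (d : ℝ)) with hg
  have hnn : ∀ (d : ℝ≥0) n, 0 ≤ η n + c n * (d : ℝ) := fun d n =>
    add_nonneg (hη n) (mul_nonneg (hc n).le d.2)
  have hle : ∀ (d : ℝ≥0) n, g d ≤ η n + c n * (d : ℝ) := fun d n =>
    ciInf_le ⟨0, by rintro _ ⟨m, rfl⟩; exact hnn d m⟩ n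
  have hg0 : ∀ d, 0 ≤ g d := fun d => le_ciInf (hnn d)
  have hmono : Monotone g := fun a b hab => le_ciInf fun n =>
    (hle a n).trans
      (add_le_add_right (mul_le_mul_of_nonneg_left (NNReal.coe_le_coe.2 hab) (hc n).le) _)
  -- Nonnegative intercepts make `g d / d` nonincreasing. With monotonicity of `g` this gives `|g b
  -- - g a| a ≤ |b - a| g a`, hence continuity away from `0`.
  have hscale : ∀ a b : ℝ≥0, 0 < b → a ≤ b → (a / b : ℝ) * g b ≤ g a := by
    intro a b hb hab
    have hb' : (0 : ℝ) < b := hb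
    have h1 : (a / b : ℝ) ≤ 1 := (div_le_one hb').2 hab
    have h0 : (0 : ℝ) ≤ a / b := by positivity
    refine le_ciInf fun n => (mul_le_mul_of_nonneg_left (hle b n) h0).trans ?_
    have h2 : (a / b : ℝ) * (η n + c n * b) = a / b * η n + c n * a := by field_simp
    rw [h2]
    have := mul_le_of_le_one_left (hη n) h1
    linarith
  have hzero : g 0 = 0 := by
    refine le_antisymm (ge_of_tendsto' hlim fun n => ?_) (hg0 0)
    simpa using hle 0 n
  refine ⟨?_, by simpa [hg] using hzero⟩
  rw [Metric.continuous_iff]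
  intro a ε hε
  rcases eq_zero_or_pos a with rfl | ha
  · obtain ⟨n, hn⟩ := (hlim.eventually (gt_mem_nhds (half_pos hε))).exists
    refine ⟨ε / 2 / c n, div_pos (half_pos hε) (hc n), fun b hb => ?_⟩
    rw [NNReal.dist_eq, NNReal.coe_zero, sub_zero, abs_of_nonneg b.coe_nonneg,
      lt_div_iff₀ (hc n)] at hb
    rw [Real.dist_eq, hzero, sub_zero, abs_of_nonneg (hg0 b)]
    linarith [hle b n]
  · have ha' : (0 : ℝ) < a := ha
    refine ⟨ε * a / (g a + 1), by have := hg0 a; positivity, fun b hb => ?_⟩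
    rw [NNReal.dist_eq, lt_div_iff₀ (by linarith [hg0 a])] at hb
    have key : |g b - g a| * a ≤ |(b : ℝ) - a| * g a := by
      rcases le_total b a with hba | hab
      · have h1 := hscale b a ha hba
        rw [div_mul_eq_mul_div, div_le_iff₀ ha'] at h1
        have h2 : (b : ℝ) ≤ a := hba
        rw [abs_of_nonpos (by linarith [hmono hba]), abs_of_nonpos (by linarith)]
        linarith
      · have hb0 : 0 < b := ha.trans_le hab
        have hb' : (0 : ℝ) < b := hb0
        have h1 := hscale a b hb0 hab
        rw [div_mul_eq_mul_div, div_le_iff₀ hb'] at h1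
        have h2 : (a : ℝ) ≤ b := hab
        rw [abs_of_nonneg (by linarith [hmono hab]), abs_of_nonneg (by linarith)]
        linarith
    rw [Real.dist_eq]
    refine lt_of_mul_lt_mul_right (a := (a : ℝ)) ?_ ha'.le
    nlinarith [abs_nonneg ((b : ℝ) - a)]

/-- `f` is a modulus of continuity bounding `e ≤ 2` in terms of `d` whenever `R d e`. -/
def IsMajorant (R : ℝ → ℝ → Prop) (f : ℝ≥0 → ℝ≥0) : Prop :=
  Continuous f ∧ f 0 = 0 ∧ ∀ d e : ℝ≥0, R d e → e ≤ 2 → e ≤ f d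

/-- Each affine function `1/(n+1) + (2/d₀ n) d` dominates `e`: below the threshold by its intercept,
above it because its linear term is at least `2`. Their infimum is the modulus. -/
theorem exists_isMajorant {R : ℝ → ℝ → Prop}
    (hR : ∀ η > 0, ∃ d₀ > 0, ∀ d e, d < d₀ → e ≤ 2 → R d e → e < η) : ∃ f, IsMajorant R f := by
  choose d₀ hd₀ H using fun n : ℕ => hR (1 / ((n : ℝ) + 1)) (by positivity)
  have hη : ∀ n : ℕ, 0 ≤ 1 / ((n : ℝ) + 1) := fun n => by positivity
  have hc : ∀ n, 0 < 2 / d₀ n := fun n => div_pos two_pos (hd₀ n)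
  obtain ⟨hcont, h0⟩ := continuous_iInf_affine hη hc tendsto_one_div_add_atTop_nhds_zero_nat
  refine ⟨fun d => ⟨⨅ n : ℕ, (1 / ((n : ℝ) + 1) + 2 / d₀ n * (d : ℝ)), ?_⟩, ?_, ?_, ?_⟩
  · exact le_ciInf fun n => add_nonneg (hη n) (mul_nonneg (hc n).le d.2)
  · exact hcont.subtype_mk _
  · exact Subtype.ext h0
  · intro d e hde he
    refine le_ciInf (α := ℝ) fun n => ?_
    change (e : ℝ) ≤ 1 / ((n : ℝ) + 1) + 2 / d₀ n * (d : ℝ)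
    rcases lt_or_ge (d : ℝ) (d₀ n) with hd | hd
    · have h1 := H n d e hd (by exact_mod_cast he) hde
      have h2 := mul_nonneg (hc n).le d.coe_nonneg
      linarith
    · have h1 : 2 ≤ 2 / d₀ n * (d : ℝ) := by
        rw [div_mul_eq_mul_div, le_div_iff₀ (hd₀ n)]
        linarith
      have h2 : (e : ℝ) ≤ 2 := by exact_mod_cast he
      linarith [hη n]

theorem IsModulusOfContinuity.uniformContinuous {A B : Type*} [MetricSpace A] [MetricSpace B]
    {f : ℝ≥0 → ℝ≥0} {F : A → B} (h : IsModulusOfContinuity f F) : UniformContinuous F := by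
  rw [Metric.uniformContinuous_iff]
  intro ε hε
  have hlim : Tendsto f (𝓝 0) (𝓝 0) := by simpa [h.2.1] using h.1.tendsto 0
  obtain ⟨δ, hδ, H⟩ := Metric.tendsto_nhds_nhds.1 hlim ε hε
  refine ⟨δ, hδ, fun {a b} hab => ?_⟩
  have h1 : dist (nndist a b) 0 < δ := by
    rwa [NNReal.dist_eq, NNReal.coe_zero, sub_zero, coe_nndist, abs_of_nonneg dist_nonneg]
  have h2 := H h1
  rw [NNReal.dist_eq, NNReal.coe_zero, sub_zero, abs_of_nonneg (NNReal.coe_nonneg _)] at h2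
  exact lt_of_le_of_lt (by exact_mod_cast h.2.2 a b) h2

end Majorant

/-! ### Composition through `ℓ²` -/

section Main

/-- The relation between the distance `d` of two points and the distance `e` of their images under
a sphere map with modulus of convexity `δ` in the target and modulus of smoothness `ρ` in the
source. -/
def sphereMapRelation (δ ρ : ℝ → ℝ) (d e : ℝ) : Prop :=
  ∀ τ > 0, δ e ≤ 2 * (d + (2 * ρ τ + d) / τ)

open Classical in
/-- A modulus of continuity determined by a modulus of convexity and a modulus of smoothness. -/
noncomputable def sphereMapModulus (δ ρ : ℝ → ℝ) : ℝ≥0 → ℝ≥0 :=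
  if h : ∃ f, IsMajorant (sphereMapRelation δ ρ) f then h.choose else 0

/-- The modulus is chosen from a relation between the two functions `δ` and `ρ` alone, so it cannot
depend on the spaces; convexity and smoothness guarantee that there is something to choose. -/
theorem isMajorant_sphereMapModulus {X Y : Type*} [NormedAddCommGroup X]
    (hX : IsUniformlySmooth X) [NormedAddCommGroup Y] [NormedSpace ℝ Y] [UniformConvexSpace Y]
    [Nontrivial Y] :
    IsMajorant (sphereMapRelation (convexityModulus Y) (smoothnessModulus X))
      (sphereMapModulus (convexityModulus Y) (smoothnessModulus X)) := by
  have h : ∃ f, IsMajorant (sphereMapRelation (convexityModulus Y) (smoothnessModulus X)) f := by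
    refine exists_isMajorant fun η hη => ?_
    obtain ⟨δ, hδ, H⟩ := exists_pos_forall_le_convexityModulus (X := Y) inferInstance hη
    obtain ⟨d₀, hd₀, H'⟩ := hX.exists_forall_lt hδ
    refine ⟨d₀, hd₀, fun d e hd he hR => ?_⟩
    by_contra! hcon
    obtain ⟨τ, hτ, hlt⟩ := H' d hd
    linarith [hR τ hτ, H e hcon he]
  rw [sphereMapModulus, dif_pos h]
  exact h.choose_spec

theorem exists_sphere_equiv_l2 (X : Type*) [NormedAddCommGroup X] [NormedSpace ℝ X] [Lattice X]
    [IsOrderedAddMonoid X] [IsOrderedModule ℝ X] [HasSolidNorm X] [CompleteSpace X]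
    [TopologicalSpace.SeparableSpace X] [UniformConvexSpace X] [Nontrivial X]
    (hfin : ¬ FiniteDimensional ℝ X) (hs : IsUniformlySmooth X) :
    ∃ G : Metric.sphere (0 : X) 1 ≃ Metric.sphere (0 : lp (fun _ : ℕ => ℝ) 2) 1,
      (∀ x y, ∀ τ > 0, dist (G x) (G y) ^ 2 ≤
        2 * (dist x y + (2 * smoothnessModulus X τ + dist x y) / τ)) ∧
      ∀ x y : Metric.sphere (0 : X) 1,
        1 - ‖(1 / 2 : ℝ) • ((x : X) + y)‖ ≤ dist (G x) (G y) ^ 2 := by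
  obtain ⟨Ω, _, μ, _, J, u, hR⟩ := exists_isFunctionRepresentation X
  obtain ⟨G, hG1, hG2⟩ := exists_sphere_equiv_L2 hR hs
  obtain ⟨T⟩ := nonempty_linearIsometryEquiv_l2_of_homeomorph_sphere hfin G
  have hT : ∀ x y, dist (T.sphereEquiv x) (T.sphereEquiv y) = dist x y := fun x y =>
    T.isometry.dist_eq _ _
  refine ⟨G.toEquiv.trans T.sphereEquiv, fun x y τ hτ => ?_, fun x y => ?_⟩
  · simp only [Equiv.trans_apply, hT]
    exact hG1 x y τ hτ
  · simp only [Equiv.trans_apply, hT]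
    exact hG2 x y

/-- The convexity estimate for the target and the smoothness estimate for the source meet at the
squared distance in `H`. Distances on a unit sphere are at most `2`, as the majorant requires. -/
theorem isModulusOfContinuity_sphere {X Y H : Type*} [NormedAddCommGroup X]
    (hX : IsUniformlySmooth X) [NormedAddCommGroup Y] [NormedSpace ℝ Y]
    [UniformConvexSpace Y] [Nontrivial Y] [MetricSpace H]
    (G : Metric.sphere (0 : X) 1 ≃ H) (G' : Metric.sphere (0 : Y) 1 ≃ H)
    (hG : ∀ x y, ∀ τ > 0, dist (G x) (G y) ^ 2 ≤
        2 * (dist x y + (2 * smoothnessModulus X τ + dist x y) / τ))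
    (hG' : ∀ x y : Metric.sphere (0 : Y) 1,
        1 - ‖(1 / 2 : ℝ) • ((x : Y) + y)‖ ≤ dist (G' x) (G' y) ^ 2) :
    IsModulusOfContinuity (sphereMapModulus (convexityModulus Y) (smoothnessModulus X))
      (G.trans G'.symm) := by
  obtain ⟨hc, h0, hle⟩ := isMajorant_sphereMapModulus (X := X) (Y := Y) hX
  refine ⟨hc, h0, fun a b => hle _ _ (fun τ hτ => ?_) ?_⟩
  · refine le_trans ?_ (hG a b τ hτ)
    have h1 := hG' (G.trans G'.symm a) (G.trans G'.symm b)
    simp only [Equiv.trans_apply, Equiv.apply_symm_apply] at h1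
    refine le_trans (convexityModulus_le (norm_eq_of_mem_sphere _) (norm_eq_of_mem_sphere _) ?_) h1
    rw [coe_nndist, Subtype.dist_eq, dist_eq_norm]
    rfl
  · rw [← NNReal.coe_le_coe, coe_nndist, Subtype.dist_eq, dist_eq_norm]
    refine (norm_sub_le _ _).trans_eq ?_
    rw [norm_eq_of_mem_sphere, norm_eq_of_mem_sphere]
    norm_num

end Main

theorem theorem2p3 :
    ∃ Φ Γ : (ℝ → ℝ) → (ℝ → ℝ) → ℝ≥0 → ℝ≥0,
      ∀ (X : Type*) [NormedAddCommGroup X] [NormedSpace ℝ X] [Lattice X] [IsOrderedAddMonoid X]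
        [IsOrderedModule ℝ X] [HasSolidNorm X] [CompleteSpace X]
        [TopologicalSpace.SeparableSpace X] [UniformConvexSpace X]
        (Y : Type*) [NormedAddCommGroup Y] [NormedSpace ℝ Y] [Lattice Y] [IsOrderedAddMonoid Y]
        [IsOrderedModule ℝ Y] [HasSolidNorm Y] [CompleteSpace Y]
        [TopologicalSpace.SeparableSpace Y] [UniformConvexSpace Y],
        ¬ FiniteDimensional ℝ X → IsUniformlySmooth X →
        ¬ FiniteDimensional ℝ Y → IsUniformlySmooth Y →
        ∃ F : Metric.sphere (0 : X) 1 ≃ᵤ Metric.sphere (0 : Y) 1,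
          IsModulusOfContinuity (Φ (convexityModulus Y) (smoothnessModulus X)) F ∧
          IsModulusOfContinuity (Γ (smoothnessModulus Y) (convexityModulus X)) F.symm := by
  refine ⟨sphereMapModulus, fun ρ δ => sphereMapModulus δ ρ, ?_⟩
  intro X _ _ _ _ _ _ _ _ _ Y _ _ _ _ _ _ _ _ _ hXfin hXs hYfin hYs
  have hXn : Nontrivial X := not_subsingleton_iff_nontrivial.1 fun _ => hXfin inferInstance
  have hYn : Nontrivial Y := not_subsingleton_iff_nontrivial.1 fun _ => hYfin inferInstance
  obtain ⟨G, hG1, hG2⟩ := exists_sphere_equiv_l2 X hXfin hXs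
  obtain ⟨G', hG1', hG2'⟩ := exists_sphere_equiv_l2 Y hYfin hYs
  have hF := isModulusOfContinuity_sphere hXs G G' hG1 hG2'
  have hF' := isModulusOfContinuity_sphere hYs G' G hG1' hG2
  exact ⟨⟨G.trans G'.symm, hF.uniformContinuous, hF'.uniformContinuous⟩, hF, hF'⟩
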